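/- Notation. For a function $h$, $h^{(i)}$ denotes its $i$-fold composition. Let $k\ge 1$ be an integer, $N>1$ and $E=\exp^{(k)}(2N)$. Let $$\Phi_{k,N}(t)=t^2\,(\ln s)^2(\ln\ln s)^2\cdots(\ln^{(k-1)}s)^2(\ln^{(k)}s)^{2N},\qquad s=\max(t^2,E),$$ and let $\kappa(j)=j^2$ for integers $1\le j\le E$, $\kappa(j)=j\ln j\cdots\ln^{(k-2)}j\,(\ln^{(k-1)}j)^{(N+1)/2}$ for $j>E$. Setting. Let $\Omega\subset\mathbb R^n$ be open and bounded and let $w$ be a measurable weight, $w>0$ a.e. in $\Omega$; write $w(S)=\int_S w\,dx$. Let $A$ be a measurable, symmetric, nonnegative semidefinite matrix function on $\Omega$ with $|A(x)\xi|\le K w(x)|\xi|$ for a.e. $x$, all $\xi$, and some constant $K$, and let $B$ be a Lipschitz matrix function on $\Omega$ with $c_0\,\xi^{\rm tr}A\xi\le|B\xi|^2\le C_0\,\xi^{\rm tr}A\xi$ a.e., where $c_0,C_0>0$. Put $\nabla_A=B\nabla$, $Lu=\nabla^{\rm tr}A\nabla u$. For open $U\subset\Omega$, $W^{1,2}_A(U)$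 is the completion of the locally Lipschitz functions on $U$ of finite norm $\left(\int_U|v|^2+\nabla v^{\rm tr}A\nabla v\right)^{1/2}$, and $(W^{1,2}_A)_0(U)$ is the closure in it of $Lip_c(U)$, the Lipschitz functions with compact support in $U$. A function $u\in W^{1,2}_A(\Omega)$ is a weak subsolution (solution) of $Lu=\phi$ in $\Omega$ if $-\int_\Omega\nabla g^{\rm tr}A\nabla u\ge\int_\Omega\phi g$ (respectively $=$) for all nonnegative $g\in(W^{1,2}_A)_0(\Omega)$ for which $\phi g$ is integrable. Let $d$ be a metric on $\Omega$ whose balls $B(x,r)=\{y\in\Omega: d(x,y)<r\}$ are open in $\mathbb R^n$. Let $\varphi$ (the superradius) be an increasing function on $[0,R]$, $R>0$, with $\varphi(0)=0$ and $\varphi(r)\ge r$. Theorem (local boundedness). Let $\mathcal B$ be a family of metric balls $B=B(x,r)$ with $x\in\Omega$, $0<r\le R$, $w(B)<\infty$. Suppose that for every ball $B=B(x,r)\in\mathcal B$: (a) (Orlicz–Sobolev) $\|v\|_{L^{\Phi_{k,N}}(\mu_B)}\le C_S\,\varphi(r)\,w(B)^{-1/2}\|\nabla_Av\|_{L^2(B)}$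 for all $v\in Lip_c(B)$, where $d\mu_B=w\,dx/w(B)$ and the left side is the Luxemburg norm $\inf\{a>0:\int\Phi_{k,N}(|v|/a)\,d\mu_B\le1\}$; (b) (adapted cutoffs) there are functions $\psi_j\in Lip_c(B(x,r_j))$, $j\ge1$, with $\psi_j=1$ on $B(x,r_{j+1})$ and $\||\nabla_A\psi_j|/w^{1/2}\|_{L^\infty}\le C_{cut}\,\kappa(j)/r$, where $r_1=r$, $r_j-r_{j+1}=cr/\kappa(j)$ and $c>0$ is determined by $\lim_j r_j=r/2$; (c) (admissibility) $v\phi$ is integrable on $B$ for every $v\in(W^{1,2}_A)_0(B)$, and $$\|\phi\|_{X(B)}=\sup_{v\in(W^{1,2}_A)_0(B)}w(\{y\in B:v(y)\ne0\})^{-1/2}\,\frac{\left|\int_Bv\phi\,dy\right|}{\|\nabla_Av\|_{L^2(B)}}<\infty .$$ Then: 1. Every weak subsolution $u$ of $Lu=\phi$ in $\Omega$ satisfies, for every ball $B=B(x,r)\in\mathcal B$, with $\frac12B=B(x,r/2)$, $$\|u_+\|_{L^\infty(\frac12B)}\le A_{k,N}(r)\left(\frac1{w(B)}\int_Bu_+^2\,w\right)^{1/2}+\|\phi\|_{X(B)},\qquad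 A_{k,N}(r)=C_1\left[\exp^{(k)}\!\left(C_2\left(\frac{\varphi(r)}r\right)^{\frac2{N-1}}\right)\right]^{1/2},$$ where $C_1,C_2>0$ depend only on $k$, $N$ and the constants $C_S,C_{cut},c_0,C_0,R$ of the hypotheses, and not on $r$. 2. If moreover $\mathcal B$ contains balls $B(x,r)$ of arbitrarily small radius $r$ around every $x\in\Omega$, then every weak solution of $Lu=\phi$ in $\Omega$ is essentially bounded on every compact subset of $\Omega$. -/

import Mathlib

open MeasureTheory Filter Topology
open scoped ENNReal NNReal

noncomputable section

namespace DegenerateDG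

/-- Euclidean space `ℝⁿ`; `n × n` matrices are identified with the operators `𝔼 n →L[ℝ] 𝔼 n`. -/
abbrev 𝔼 (n : ℕ) : Type := EuclideanSpace ℝ (Fin n)

/-! ### Young functions, Luxemburg norm, radii -/

/-- The threshold `E_{k,N} = exp^{(k)}(2N)`. -/
def threshold (k : ℕ) (N : ℝ) : ℝ := Real.exp^[k] (2 * N)

/-- `(ln s)² (ln ln s)² ⋯ (ln^{(k-1)} s)² (ln^{(k)} s)^{2N}`. -/
def logBump (k : ℕ) (N s : ℝ) : ℝ :=
  (∏ i ∈ Finset.Icc 1 (k - 1), (Real.log^[i] s) ^ 2) * (Real.log^[k] s) ^ (2 * N)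

/-- The Young function `Φ_{k,N}`. -/
def youngPhi (k : ℕ) (N t : ℝ) : ℝ :=
  if threshold k N ≤ t ^ 2 then t ^ 2 * logBump k N (t ^ 2)
  else t ^ 2 * logBump k N (threshold k N)

/-- The Luxemburg norm `inf {a > 0 : ∫ Φ(|v|/a) dν ≤ 1}`, equal to `∞` if there is no such `a`. -/
def luxemburgNorm {X : Type*} [MeasurableSpace X] (Φ : ℝ → ℝ) (ν : Measure X) (v : X → ℝ) :
    ℝ≥0∞ :=
  ⨅ (a : ℝ) (_ : 0 < a) (_ : ∫⁻ y, ENNReal.ofReal (Φ (|v y| / a)) ∂ν ≤ 1), ENNReal.ofReal a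

/-- `κ_{k,N}(j)`: `j²` for `j ≤ E`, and `j ln j ⋯ ln^{(k-2)} j (ln^{(k-1)} j)^{(N+1)/2}`
for `j > E`. -/
def kappa (k : ℕ) (N : ℝ) (j : ℕ) : ℝ :=
  if (j : ℝ) ≤ threshold k N then (j : ℝ) ^ 2
  else (∏ i ∈ Finset.range (k - 1), Real.log^[i] (j : ℝ)) *
    (Real.log^[k - 1] (j : ℝ)) ^ ((N + 1) / 2)

/-- The radii `r₁ = r`, `r_j - r_{j+1} = c r / κ(j)`, `r_j → r / 2`
(the limit determines the constant `c`). The value `ρ 0` is not used. -/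
def IsAdaptedRadii (k : ℕ) (N r : ℝ) (ρ : ℕ → ℝ) : Prop :=
  ρ 1 = r ∧ Tendsto ρ atTop (𝓝 (r / 2)) ∧
    ∃ c : ℝ, 0 < c ∧ ∀ j : ℕ, 1 ≤ j → ρ j - ρ (j + 1) = c * r / kappa k N j

/-- `φ` is an increasing function on `[0, R]` with `φ(0) = 0` and `φ(r) ≥ r`. -/
structure IsSuperradius (R : ℝ) (φ : ℝ → ℝ) : Prop where
  mono : MonotoneOn φ (Set.Icc 0 R)
  zero : φ 0 = 0
  le : ∀ r ∈ Set.Icc 0 R, r ≤ φ r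

/-- `A_{k,N}(r) = C₁ [exp^{(k)}(C₂ (φ(r)/r)^{2/(N-1)})]^{1/2}`. -/
def innerConst (k : ℕ) (N C₁ C₂ : ℝ) (φ : ℝ → ℝ) (r : ℝ) : ℝ :=
  C₁ * (Real.exp^[k] (C₂ * (φ r / r) ^ (2 / (N - 1)))) ^ (1 / 2 : ℝ)

/-! ### The metric, the weight and the coefficient matrix -/

variable {n : ℕ}

/-- The metric ball `B(x, r) = {y ∈ Ω : d(x, y) < r}`. -/
def mball (Ω : Set (𝔼 n)) (d : 𝔼 n → 𝔼 n → ℝ) (x : 𝔼 n) (r : ℝ) : Set (𝔼 n) :=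
  {y | y ∈ Ω ∧ d x y < r}

/-- `d` restricts to a metric on `Ω`, and its balls are open in the Euclidean topology. -/
structure IsMetricOn (Ω : Set (𝔼 n)) (d : 𝔼 n → 𝔼 n → ℝ) : Prop where
  nonneg : ∀ x ∈ Ω, ∀ y ∈ Ω, 0 ≤ d x y
  eq_zero_iff : ∀ x ∈ Ω, ∀ y ∈ Ω, d x y = 0 ↔ x = y
  symm : ∀ x ∈ Ω, ∀ y ∈ Ω, d x y = d y x
  triangle : ∀ x ∈ Ω, ∀ y ∈ Ω, ∀ z ∈ Ω, d x z ≤ d x y + d y z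
  isOpen_ball : ∀ x ∈ Ω, ∀ r : ℝ, IsOpen (mball Ω d x r)

/-- The measure `w(x) dx` on `Ω`. -/
def wMeasure (Ω : Set (𝔼 n)) (w : 𝔼 n → ℝ) : Measure (𝔼 n) :=
  (volume.restrict Ω).withDensity fun x => ENNReal.ofReal (w x)

/-- The normalized measure `dμ_B = w(x) dx / w(B)` on a set `S` (a ball). -/
def normMeasure (Ω : Set (𝔼 n)) (w : 𝔼 n → ℝ) (S : Set (𝔼 n)) : Measure (𝔼 n) :=
  (wMeasure Ω w S)⁻¹ • (wMeasure Ω w).restrict S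

/-- Standing assumptions on the bounded open set `Ω`, the weight `w`, the symmetric nonnegative
semidefinite matrix `A` with `|A ξ| ≤ K w |ξ|`, and the Lipschitz matrix `B` with
`c ξᵗAξ ≤ |Bξ|² ≤ C ξᵗAξ`. -/
structure DegenerateStructure (Ω : Set (𝔼 n)) (A B : 𝔼 n → 𝔼 n →L[ℝ] 𝔼 n) (w : 𝔼 n → ℝ)
    (c C : ℝ) : Prop where
  isOpen : IsOpen Ω
  bounded : Bornology.IsBounded Ω
  aemeasurable_weight : AEMeasurable w (volume.restrict Ω)
  weight_pos : ∀ᵐ x ∂volume.restrict Ω, 0 < w x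
  aemeasurable_matrix : AEStronglyMeasurable A (volume.restrict Ω)
  matrix_nonneg : ∀ᵐ x ∂volume.restrict Ω, (A x).IsPositive
  matrix_le : ∃ K : ℝ, 0 < K ∧ ∀ᵐ x ∂volume.restrict Ω, ∀ ξ : 𝔼 n, ‖A x ξ‖ ≤ K * w x * ‖ξ‖
  lipschitz : ∃ K : ℝ≥0, LipschitzOnWith K B Ω
  comparable : ∀ᵐ x ∂volume.restrict Ω, ∀ ξ : 𝔼 n,
    c * inner ℝ ξ (A x ξ) ≤ ‖B x ξ‖ ^ 2 ∧ ‖B x ξ‖ ^ 2 ≤ C * inner ℝ ξ (A x ξ)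

/-! ### Lipschitz functions and degenerate Sobolev spaces -/

/-- `v ∈ Lip_c(U)`: Lipschitz with compact support contained in `U`. -/
def IsLipC (U : Set (𝔼 n)) (v : 𝔼 n → ℝ) : Prop :=
  (∃ K : ℝ≥0, LipschitzWith K v) ∧ HasCompactSupport v ∧ tsupport v ⊆ U

/-- The energy `∫_U Gᵗ A G dx` of a vector field. -/
def energy (A : 𝔼 n → 𝔼 n →L[ℝ] 𝔼 n) (U : Set (𝔼 n)) (G : 𝔼 n → 𝔼 n) : ℝ≥0∞ :=
  ∫⁻ x in U, ENNReal.ofReal (inner ℝ (G x) (A x (G x)))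

/-- `v ∈ L²(U)`, the field `G` has finite energy, and `(v, G)` is the limit of `(f_m, ∇f_m)` in the
norm `(∫_U |v|² + Gᵗ A G)^{1/2}`. -/
def IsLimitOfGradients (A : 𝔼 n → 𝔼 n →L[ℝ] 𝔼 n) (U : Set (𝔼 n)) (v : 𝔼 n → ℝ) (G : 𝔼 n → 𝔼 n)
    (f : ℕ → 𝔼 n → ℝ) : Prop :=
  MemLp v 2 (volume.restrict U) ∧ AEStronglyMeasurable G (volume.restrict U) ∧
    energy A U G < ∞ ∧
    Tendsto (fun m => eLpNorm (fun x => f m x - v x) 2 (volume.restrict U)) atTop (𝓝 0) ∧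
    Tendsto (fun m => energy A U (fun x => gradient (f m) x - G x)) atTop (𝓝 0)

/-- `v ∈ W_A^{1,2}(U)` with gradient `G` (a field determined modulo the kernel of `A`): the
completion, in the norm of `W_A^{1,2}`, of the locally Lipschitz functions of finite norm. -/
def MemW (A : 𝔼 n → 𝔼 n →L[ℝ] 𝔼 n) (U : Set (𝔼 n)) (v : 𝔼 n → ℝ) (G : 𝔼 n → 𝔼 n) : Prop :=
  ∃ f : ℕ → 𝔼 n → ℝ, (∀ m, LocallyLipschitzOn U (f m)) ∧ IsLimitOfGradients A U v G f

/-- `v ∈ (W_A^{1,2})₀(U)` with gradient `G`: the closure of `Lip_c(U)` in `W_A^{1,2}(U)`. -/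
def MemWZero (A : 𝔼 n → 𝔼 n →L[ℝ] 𝔼 n) (U : Set (𝔼 n)) (v : 𝔼 n → ℝ) (G : 𝔼 n → 𝔼 n) : Prop :=
  ∃ f : ℕ → 𝔼 n → ℝ, (∀ m, IsLipC U (f m)) ∧ IsLimitOfGradients A U v G f

/-! ### Orlicz–Sobolev inequality, cutoff functions, admissibility -/

/-- The Orlicz–Sobolev inequality on `B(x, r)` with Young function `Φ`, value `φr = φ(r)` of the
superradius and constant `C`:
`‖v‖_{L^Φ(μ_B)} ≤ C φ(r) w(B)^{-1/2} ‖∇_A v‖_{L²}` for all `v ∈ Lip_c(B)`. -/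
def OrliczSobolevOn (Ω : Set (𝔼 n)) (B : 𝔼 n → 𝔼 n →L[ℝ] 𝔼 n) (w : 𝔼 n → ℝ)
    (d : 𝔼 n → 𝔼 n → ℝ) (Φ : ℝ → ℝ) (C φr : ℝ) (x : 𝔼 n) (r : ℝ) : Prop :=
  ∀ v : 𝔼 n → ℝ, IsLipC (mball Ω d x r) v →
    luxemburgNorm Φ (normMeasure Ω w (mball Ω d x r)) v ≤
      ENNReal.ofReal (C * φr) * (wMeasure Ω w (mball Ω d x r)) ^ (-(1 / 2) : ℝ) *
        eLpNorm (fun y => B y (gradient v y)) 2 (volume.restrict (mball Ω d x r))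

/-- There is an adapted sequence of Lipschitz cutoff functions at `(x, r)`, with constant `C` in
the bound `‖ |∇_A ψ_j| / w^{1/2} ‖_{L^∞} ≤ C κ_{k,N}(j) / r`. -/
def HasAdaptedCutoffs (Ω : Set (𝔼 n)) (B : 𝔼 n → 𝔼 n →L[ℝ] 𝔼 n) (w : 𝔼 n → ℝ)
    (d : 𝔼 n → 𝔼 n → ℝ) (k : ℕ) (N C : ℝ) (x : 𝔼 n) (r : ℝ) : Prop :=
  ∃ (ρ : ℕ → ℝ) (ψ : ℕ → 𝔼 n → ℝ), IsAdaptedRadii k N r ρ ∧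
    ∀ j : ℕ, 1 ≤ j →
      IsLipC (mball Ω d x (ρ j)) (ψ j) ∧
      (∀ y ∈ mball Ω d x (ρ (j + 1)), ψ j y = 1) ∧
      ∀ᵐ y ∂volume.restrict Ω,
        ‖B y (gradient (ψ j) y)‖ / (w y) ^ (1 / 2 : ℝ) ≤ C * kappa k N j / r

/-- `‖f‖_{X(S)}`: the supremum over `v ∈ (W_A^{1,2})₀(S)` of
`w({v ≠ 0})^{-1/2} |∫_S v f| / ‖∇_A v‖_{L²(S)}`. The function `v = 0` contributes `0`. -/
def xNorm (Ω : Set (𝔼 n)) (A B : 𝔼 n → 𝔼 n →L[ℝ] 𝔼 n) (w : 𝔼 n → ℝ) (S : Set (𝔼 n))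
    (f : 𝔼 n → ℝ) : ℝ≥0∞ :=
  ⨆ (v : 𝔼 n → ℝ) (G : 𝔼 n → 𝔼 n) (_ : MemWZero A S v G),
    (wMeasure Ω w {y | y ∈ S ∧ v y ≠ 0}) ^ (-(1 / 2) : ℝ) * ENNReal.ofReal |∫ y in S, v y * f y| /
      eLpNorm (fun y => B y (G y)) 2 (volume.restrict S)

/-- `f` is `A`-admissible on `S`: the integrals in `‖f‖_{X(S)}` make sense, and the supremum is
finite. -/
def IsAdmissible (Ω : Set (𝔼 n)) (A B : 𝔼 n → 𝔼 n →L[ℝ] 𝔼 n) (w : 𝔼 n → ℝ) (S : Set (𝔼 n))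
    (f : 𝔼 n → ℝ) : Prop :=
  (∀ (v : 𝔼 n → ℝ) (G : 𝔼 n → 𝔼 n), MemWZero A S v G → IntegrableOn (fun y => v y * f y) S) ∧
    xNorm Ω A B w S f < ∞

/-! ### Weak solutions -/

/-- `g` is a nonnegative function of `(W_A^{1,2})₀(Ω)` with gradient `H` for which `∫_Ω f g`
makes sense. -/
def IsTestFunction (Ω : Set (𝔼 n)) (A : 𝔼 n → 𝔼 n →L[ℝ] 𝔼 n) (f g : 𝔼 n → ℝ)
    (H : 𝔼 n → 𝔼 n) : Prop :=
  MemWZero A Ω g H ∧ (∀ᵐ x ∂volume.restrict Ω, 0 ≤ g x) ∧ IntegrableOn (fun x => f x * g x) Ω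

/-- `u ∈ W_A^{1,2}(Ω)` is a weak subsolution of `∇ᵗ A ∇ u = f` in `Ω`. -/
def IsWeakSubsolution (Ω : Set (𝔼 n)) (A : 𝔼 n → 𝔼 n →L[ℝ] 𝔼 n) (f u : 𝔼 n → ℝ) : Prop :=
  ∃ G : 𝔼 n → 𝔼 n, MemW A Ω u G ∧
    ∀ (g : 𝔼 n → ℝ) (H : 𝔼 n → 𝔼 n), IsTestFunction Ω A f g H →
      -(∫ x in Ω, inner ℝ (H x) (A x (G x))) ≥ ∫ x in Ω, f x * g x

/-- `u ∈ W_A^{1,2}(Ω)` is a weak solution of `∇ᵗ A ∇ u = f` in `Ω`. -/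
def IsWeakSolution (Ω : Set (𝔼 n)) (A : 𝔼 n → 𝔼 n →L[ℝ] 𝔼 n) (f u : 𝔼 n → ℝ) : Prop :=
  ∃ G : 𝔼 n → 𝔼 n, MemW A Ω u G ∧
    ∀ (g : 𝔼 n → ℝ) (H : 𝔼 n → 𝔼 n), IsTestFunction Ω A f g H →
      -(∫ x in Ω, inner ℝ (H x) (A x (G x))) = ∫ x in Ω, f x * g x

/-- `u` is essentially bounded on every compact subset of `Ω`. -/
def IsLocallyBounded (Ω : Set (𝔼 n)) (u : 𝔼 n → ℝ) : Prop :=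
  ∀ K : Set (𝔼 n), IsCompact K → K ⊆ Ω → eLpNorm u ∞ (volume.restrict K) < ∞

end DegenerateDG

end

namespace DegenerateDG

/-! ### Iterated exponentials and logarithms -/

/-! The proof is a De Giorgi iteration in which geometric decay of the truncated energies is imposed
in advance. On a ball of radius `r` fix a number `L` above the right-hand side of the estimate, use
the adapted radii `ρ j` and the levels `l_j = 2L(1 - ρ j / r)`, which increase from `0` towards `L`,
and show inductively that the `w`-integral of `(u - l_j)₊²` over `B(x, ρ j)` is at most `L² y_j
w(B)` with `y_(j+1) = e⁻³ y_j`. In the limit `(u - L)₊ = 0` a.e. on the half ball.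

One step (`iteration_step`) combines three facts about `v = η (u - l_(j+1))₊`. The Caccioppoli
inequality bounds `‖∇_A v‖²` by `L² y_j κ(j)² w(B) / r²`; the inhomogeneous term fits in because `L
≥ ‖φ‖_X`. Chebyshev's inequality bounds `w{u > l_(j+1)}` by a multiple of `κ(j)² y_j w(B)`. The
Orlicz–Sobolev inequality is used only through the minorant `Φ(t) ≥ b(M)(t² - M)`, with `b =
logBump` and `M` free: if the Luxemburg norm of `v` is below `a`, then the integral of `v²` is at
most `a² M w{v ≠ 0} + a² w(B) / b(M)`. No Hölder inequality in Orlicz spaces and no inverse of `Φ`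
are needed.

The step closes if `b(M_j) ≳ (φ(r)/r)² κ(j)²` and `M_j b(M_j) κ(j)² y_j ≲ 1`. With `M_j = exp(j +
m)` and `m = exp^(k-1)(T)`, the logarithms of `M_j` dominate those of `j`, hence `κ(j)²`, and leave
a factor `T^(N-1)`; so `T ~ (φ(r)/r)^(2/(N-1))` suffices (`exists_iteration_constants`). The second
condition allows `y_1 ~ exp(-3m)`, and `y_1^(-1/2)` is the constant `A_{k,N}(r)`.

For solutions the estimate is applied to `u` and `-u`, once `u₊²` is known to be `w`-integrable on
small balls. -/

lemma le_exp_iterate (i : ℕ) (x : ℝ) : x ≤ Real.exp^[i] x := by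
  induction i with
  | zero => simp
  | succ i ih =>
    rw [Function.iterate_succ_apply']
    linarith [Real.add_one_le_exp (Real.exp^[i] x)]

lemma exp_iterate_mono (i : ℕ) : Monotone (Real.exp^[i]) :=
  Real.exp_monotone.iterate i

lemma le_log_iterate {i : ℕ} {x s : ℝ} (h : Real.exp^[i] x ≤ s) : x ≤ Real.log^[i] s := by
  induction i generalizing s with
  | zero => simpa using h
  | succ i ih =>
    rw [Function.iterate_succ_apply'] at h
    rw [Function.iterate_succ_apply]
    exact ih ((Real.le_log_iff_exp_le ((Real.exp_pos _).trans_le h)).2 h)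

lemma log_iterate_le_log_iterate {i : ℕ} {x s t : ℝ} (h : Real.exp^[i] x ≤ s) (hst : s ≤ t) :
    Real.log^[i] s ≤ Real.log^[i] t := by
  induction i generalizing s t with
  | zero => simpa using hst
  | succ i ih =>
    rw [Function.iterate_succ_apply'] at h
    rw [Function.iterate_succ_apply, Function.iterate_succ_apply]
    have hs : 0 < s := (Real.exp_pos _).trans_le h
    exact ih ((Real.le_log_iff_exp_le hs).2 h) (Real.log_le_log hs hst)

lemma three_mul_exp_iterate_le {x : ℝ} (hx : 1 ≤ x) (i : ℕ) :
    3 * Real.exp^[i] x ≤ Real.exp^[i] (3 * x) := by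
  induction i with
  | zero => simp
  | succ i ih =>
    rw [Function.iterate_succ_apply', Function.iterate_succ_apply']
    set y := Real.exp^[i] x
    have hy : 1 ≤ y := hx.trans (le_exp_iterate i x)
    calc 3 * Real.exp y ≤ Real.exp (2 * y) * Real.exp y := by
          gcongr
          linarith [Real.add_one_le_exp (2 * y)]
      _ = Real.exp (3 * y) := by rw [← Real.exp_add]; ring_nf
      _ ≤ _ := Real.exp_le_exp.2 ih

/-! ### The logarithmic factor and `kappa` beyond the threshold, and the numerical constants. -/

variable {k : ℕ} {N : ℝ}

lemma exp_iterate_le_threshold {i : ℕ} (hi : i ≤ k) (hN : 1 < N) :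
    Real.exp^[i] 2 ≤ threshold k N := by
  unfold threshold
  conv_rhs => rw [← Nat.add_sub_cancel' hi, Function.iterate_add_apply]
  refine exp_iterate_mono i (le_trans ?_ (le_exp_iterate _ _))
  linarith

lemma two_le_threshold (hN : 1 < N) : 2 ≤ threshold k N :=
  exp_iterate_le_threshold (i := 0) (Nat.zero_le _) hN

lemma two_le_log_iterate {i : ℕ} (hi : i ≤ k) (hN : 1 < N) {s : ℝ} (hs : threshold k N ≤ s) :
    2 ≤ Real.log^[i] s :=
  le_log_iterate ((exp_iterate_le_threshold hi hN).trans hs)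

lemma log_iterate_mono_of_threshold {i : ℕ} (hi : i ≤ k) (hN : 1 < N) {s t : ℝ}
    (hs : threshold k N ≤ s) (hst : s ≤ t) : Real.log^[i] s ≤ Real.log^[i] t :=
  log_iterate_le_log_iterate ((exp_iterate_le_threshold hi hN).trans hs) hst

lemma logBump_mono (hN : 1 < N) {s t : ℝ} (hs : threshold k N ≤ s) (hst : s ≤ t) :
    logBump k N s ≤ logBump k N t := by
  unfold logBump
  have hk := two_le_log_iterate le_rfl hN hs
  refine mul_le_mul ?_ ?_ (by positivity) (Finset.prod_nonneg fun i _ => sq_nonneg _)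
  · refine Finset.prod_le_prod (fun i _ => sq_nonneg _) fun i hi => ?_
    have hi' : i ≤ k := by have := (Finset.mem_Icc.1 hi).2; omega
    have := two_le_log_iterate hi' hN hs
    have := log_iterate_mono_of_threshold hi' hN hs hst
    gcongr
  · exact Real.rpow_le_rpow (by linarith) (log_iterate_mono_of_threshold le_rfl hN hs hst)
      (by linarith)

lemma one_le_prod_log_sq (hN : 1 < N) {s : ℝ} (hs : threshold k N ≤ s) :
    1 ≤ ∏ i ∈ Finset.Icc 1 (k - 1), (Real.log^[i] s) ^ 2 := by
  refine Finset.prod_induction (fun i => (Real.log^[i] s) ^ 2) (fun x => 1 ≤ x)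
    (fun a b ha hb => one_le_mul_of_one_le_of_one_le ha hb) le_rfl fun i hi => ?_
  have hi' : i ≤ k := by have := (Finset.mem_Icc.1 hi).2; omega
  have := two_le_log_iterate hi' hN hs
  nlinarith

lemma rpow_log_iterate_le_logBump (hN : 1 < N) {s : ℝ} (hs : threshold k N ≤ s) :
    (Real.log^[k] s) ^ (2 * N) ≤ logBump k N s := by
  have hk := two_le_log_iterate le_rfl hN hs
  exact le_mul_of_one_le_left (by positivity) (one_le_prod_log_sq hN hs)

lemma one_le_logBump (hN : 1 < N) {s : ℝ} (hs : threshold k N ≤ s) : 1 ≤ logBump k N s := by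
  have hk := two_le_log_iterate le_rfl hN hs
  exact (Real.one_le_rpow (by linarith) (by linarith)).trans (rpow_log_iterate_le_logBump hN hs)

lemma one_le_kappa (hN : 1 < N) {j : ℕ} (hj : 1 ≤ j) : 1 ≤ kappa k N j := by
  have hj' : (1 : ℝ) ≤ j := by exact_mod_cast hj
  unfold kappa
  split_ifs with h
  · nlinarith
  · have h' := (not_le.1 h).le
    refine one_le_mul_of_one_le_of_one_le ?_ ?_
    · refine Finset.prod_induction (fun i => (Real.log^[i] (j : ℝ))) (fun x => 1 ≤ x)
        (fun a b ha hb => one_le_mul_of_one_le_of_one_le ha hb) le_rfl fun i hi => ?_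
      have hi' : i ≤ k := by have := Finset.mem_range.1 hi; omega
      linarith [two_le_log_iterate hi' hN h']
    · exact Real.one_le_rpow (by linarith [two_le_log_iterate (k.sub_le 1) hN h']) (by linarith)

/-- The growth of `κ` is controlled by the logarithmic factor of the Young function. -/
lemma kappa_sq_mul_rpow_le (hk : 1 ≤ k) (hN : 1 < N) {j : ℕ} {s T : ℝ}
    (hT : 2 * N ≤ T) (hTs : Real.exp^[k] T ≤ s) (hjs : Real.exp j ≤ s) :
    kappa k N j ^ 2 * T ^ (N - 1) ≤ threshold k N ^ 4 * logBump k N s := by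
  have hE : 2 ≤ threshold k N := two_le_threshold hN
  have hs : threshold k N ≤ s := (exp_iterate_mono k hT).trans hTs
  have hTl : T ≤ Real.log^[k] s := le_log_iterate hTs
  have hT1 : 1 ≤ T := by linarith
  have hl1 : 1 ≤ Real.log^[k] s := hT1.trans hTl
  unfold kappa
  split_ifs with h
  -- Here `κ(j)² = j⁴ ≤ E⁴`; this case is the only source of the factor `E⁴`.
  · have h1 : ((j : ℝ) ^ 2) ^ 2 ≤ threshold k N ^ 4 := by
      rw [← pow_mul]
      exact pow_le_pow_left₀ (by positivity) h 4
    have h2 : T ^ (N - 1) ≤ logBump k N s :=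
      calc T ^ (N - 1) ≤ T ^ (2 * N) := Real.rpow_le_rpow_of_exponent_le hT1 (by linarith)
        _ ≤ (Real.log^[k] s) ^ (2 * N) := Real.rpow_le_rpow (by linarith) hTl (by linarith)
        _ ≤ _ := rpow_log_iterate_le_logBump hN hs
    exact mul_le_mul h1 h2 (by positivity) (by positivity)
  · have h' := (not_le.1 h).le
    have hjl : (j : ℝ) ≤ Real.log s := (Real.le_log_iff_exp_le (by linarith)).2 hjs
    -- Since `j ≤ ln s`, each logarithm of `j` is compared with the next one of `s`. The shift
    -- matches the product in `κ`, which starts at `j`, with the one in `logBump`, which starts at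
    -- `ln s`.
    have hcomp : ∀ i, i ≤ k → Real.log^[i] (j : ℝ) ≤ Real.log^[i + 1] s := fun i hi => by
      rw [Function.iterate_succ_apply]
      exact log_iterate_mono_of_threshold hi hN h' hjl
    have hj0 : 2 ≤ Real.log^[k - 1] (j : ℝ) := two_le_log_iterate (k.sub_le 1) hN h'
    have hlast : Real.log^[k - 1] (j : ℝ) ≤ Real.log^[k] s := by
      have := hcomp (k - 1) (k.sub_le 1)
      rwa [Nat.sub_add_cancel hk] at this
    have h1 : (∏ i ∈ Finset.range (k - 1), Real.log^[i] (j : ℝ)) ^ 2 ≤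
        ∏ i ∈ Finset.Icc 1 (k - 1), (Real.log^[i] s) ^ 2 := by
      rw [← Finset.prod_pow]
      have : Finset.Icc 1 (k - 1) = Finset.Ico 1 (k - 1 + 1) := by ext; simp
      rw [this, Finset.prod_Ico_eq_prod_range]
      refine Finset.prod_le_prod (fun i _ => sq_nonneg _) fun i hi => ?_
      have hi' : i ≤ k := by have := Finset.mem_range.1 hi; omega
      rw [add_comm 1 i]
      have := two_le_log_iterate hi' hN h'
      have := hcomp i hi'
      gcongr
    -- The exponent splits as `2N = (N + 1) + (N - 1)`: the first part absorbs the square of the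
    -- last factor of `κ`, the second supplies `T^(N-1)`. This is where the exponent `(N + 1)/2`
    -- comes from.
    have h2 : ((Real.log^[k - 1] (j : ℝ)) ^ ((N + 1) / 2)) ^ 2 * T ^ (N - 1) ≤
        (Real.log^[k] s) ^ (2 * N) := by
      rw [← Real.rpow_mul_natCast (by linarith)]
      calc _ ≤ (Real.log^[k] s) ^ (N + 1) * (Real.log^[k] s) ^ (N - 1) := by
            refine mul_le_mul ?_ (Real.rpow_le_rpow (by linarith) hTl (by linarith))
              (by positivity) (by positivity)
            have : (N + 1) / 2 * ((2 : ℕ) : ℝ) = N + 1 := by push_cast; ring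
            rw [this]
            exact Real.rpow_le_rpow (by linarith) hlast (by linarith)
        _ = _ := by rw [← Real.rpow_add (by linarith)]; ring_nf
    calc _ = (∏ i ∈ Finset.range (k - 1), Real.log^[i] (j : ℝ)) ^ 2 *
          (((Real.log^[k - 1] (j : ℝ)) ^ ((N + 1) / 2)) ^ 2 * T ^ (N - 1)) := by ring
      _ ≤ logBump k N s := mul_le_mul h1 h2 (by positivity)
          (Finset.prod_nonneg fun i _ => sq_nonneg _)
      _ ≤ _ := le_mul_of_one_le_left (zero_le_one.trans (one_le_logBump hN hs))
          (one_le_pow₀ (by linarith))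

lemma log_iterate_le_log {i : ℕ} (hi : i + 1 ≤ k) (hN : 1 < N) {s : ℝ} (hs : threshold k N ≤ s) :
    Real.log^[i + 1] s ≤ Real.log s := by
  induction i with
  | zero => simp
  | succ i ih =>
    rw [Function.iterate_succ_apply']
    have := two_le_log_iterate (i := i + 1) (by omega) hN hs
    exact (Real.log_le_self (by linarith)).trans (ih (by omega))

/-- The logarithmic factor of the Young function grows at most linearly. -/
lemma exists_logBump_le (hk : 1 ≤ k) (hN : 1 < N) :
    ∃ C : ℝ, 0 < C ∧ ∀ s, threshold k N ≤ s → logBump k N s ≤ C * s := by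
  -- Every iterated logarithm is at most `ln s`, so the bump is at most `(ln s)^p`, and `ln s ≤ p
  -- s^(1/p)`.
  set p : ℝ := 2 * (k - 1 : ℕ) + 2 * N with hp
  have hp0 : 0 < p := by positivity
  refine ⟨p ^ p, by positivity, fun s hs => ?_⟩
  have hs2 : 2 ≤ s := (two_le_threshold hN).trans hs
  have hlog : 2 ≤ Real.log s := by simpa using two_le_log_iterate hk hN hs
  calc logBump k N s ≤ (Real.log s ^ 2) ^ (k - 1) * Real.log s ^ (2 * N) := by
        unfold logBump
        have hkk := two_le_log_iterate le_rfl hN hs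
        refine mul_le_mul ?_ ?_ (by positivity) (by positivity)
        · have hcard : (Finset.Icc 1 (k - 1)).card = k - 1 := by simp
          conv_rhs => rw [← hcard]
          rw [← Finset.prod_const]
          refine Finset.prod_le_prod (fun i _ => sq_nonneg _) fun i hi => ?_
          obtain ⟨hi1, hi2⟩ := Finset.mem_Icc.1 hi
          have h2 := two_le_log_iterate (i := i) (by omega) hN hs
          have := log_iterate_le_log (i := i - 1) (by omega) hN hs
          rw [Nat.sub_add_cancel hi1] at this
          gcongr
        · have := log_iterate_le_log (i := k - 1) (by omega) hN hs
          rw [Nat.sub_add_cancel hk] at this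
          exact Real.rpow_le_rpow (by linarith) this (by linarith)
    _ = Real.log s ^ p := by
        rw [hp, Real.rpow_add (by linarith), ← pow_mul, ← Real.rpow_natCast]
        push_cast
        rfl
    _ ≤ (s ^ (1 / p) / (1 / p)) ^ p :=
        Real.rpow_le_rpow (by linarith) (Real.log_le_rpow_div (by linarith) (by positivity)) hp0.le
    _ = p ^ p * s := by
        rw [div_div_eq_mul_div, div_one, Real.mul_rpow (by positivity) hp0.le,
          ← Real.rpow_mul (by linarith), one_div_mul_cancel hp0.ne', Real.rpow_one, mul_comm]

/-- The numerical part of the De Giorgi iteration: levels `M j` of the Young function and a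
geometric sequence `y j` whose initial value is not smaller than `A_{k,N}(r)⁻²`. -/
lemma exists_iteration_constants (hk : 1 ≤ k) (hN : 1 < N) {D : ℝ} (hD : 0 < D) :
    ∃ C₁ C₂ : ℝ, 0 < C₁ ∧ 0 < C₂ ∧ ∀ θ : ℝ, 1 ≤ θ → ∃ y M : ℕ → ℝ,
      (∀ j, 1 ≤ j → 0 < y j ∧ threshold k N ≤ M j ∧
        D * θ ^ 2 * kappa k N j ^ 2 ≤ logBump k N (M j) ∧
        D * M j * logBump k N (M j) * kappa k N j ^ 2 * y j ≤ 1) ∧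
      (∀ j, y (j + 1) = Real.exp (-3) * y j) ∧
      1 ≤ (C₁ * (Real.exp^[k] (C₂ * θ ^ (2 / (N - 1)))) ^ (1 / 2 : ℝ)) ^ 2 * y 1 := by
  obtain ⟨C, hC, hCb⟩ := exists_logBump_le hk hN
  have hE : 2 ≤ threshold k N := two_le_threshold hN
  set E := threshold k N with hEdef
  have hN1 : 0 < N - 1 := by linarith
  -- The first entry gives `D θ² E⁴ ≤ T^(N-1)`, the second `T ≥ 2N`, which puts `exp^(k)(T)` above
  -- the threshold.
  set cT : ℝ := max ((D * E ^ 4) ^ (1 / (N - 1))) (2 * N) with hcT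
  have hcT0 : 0 < cT := lt_of_lt_of_le (by linarith) (le_max_right _ _)
  set Q : ℝ := D * E ^ 4 * C ^ 2 * Real.exp 3 with hQ
  have hQ0 : 0 < Q := by positivity
  refine ⟨Real.sqrt Q, 3 * cT, Real.sqrt_pos.2 hQ0, by positivity, fun θ hθ => ?_⟩
  set T : ℝ := cT * θ ^ (2 / (N - 1)) with hT
  have hθ1 : 1 ≤ θ ^ (2 / (N - 1)) := Real.one_le_rpow hθ (by positivity)
  have hTN : 2 * N ≤ T := (le_max_right _ _).trans (le_mul_of_one_le_right hcT0.le hθ1)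
  have hT1 : 1 ≤ T := by linarith
  have hTpow : D * θ ^ 2 * E ^ 4 ≤ T ^ (N - 1) := by
    rw [hT, Real.mul_rpow hcT0.le (by positivity), ← Real.rpow_mul (by linarith),
      div_mul_cancel₀ _ hN1.ne']
    have : D * E ^ 4 ≤ cT ^ (N - 1) := by
      calc D * E ^ 4 = ((D * E ^ 4) ^ (1 / (N - 1))) ^ (N - 1) := by
            rw [← Real.rpow_mul (by positivity), one_div_mul_cancel hN1.ne', Real.rpow_one]
        _ ≤ _ := Real.rpow_le_rpow (by positivity) (le_max_left _ _) hN1.le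
    have h2 : θ ^ (2 : ℝ) = θ ^ 2 := by norm_cast
    rw [h2]
    nlinarith [sq_nonneg θ]
  set m : ℝ := Real.exp^[k - 1] T with hm
  have hexpm : Real.exp m = Real.exp^[k] T := by
    rw [hm, ← Function.iterate_succ_apply' Real.exp, Nat.succ_eq_add_one, Nat.sub_add_cancel hk]
  have hm0 : 0 ≤ m := by linarith [le_exp_iterate (k - 1) T]
  -- Both `b(M)` and `κ²` are `O(M)`, so `M b κ²` is `O(M³)`; hence `y_j` is taken proportional to
  -- `M_j⁻³`, and `Q` normalizes the product to `1`.
  set y : ℕ → ℝ := fun j => Q⁻¹ * Real.exp (-3 * m) * Real.exp (-3 * ((j : ℝ) - 1)) with hy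
  set M : ℕ → ℝ := fun j => Real.exp (j + m) with hM
  refine ⟨y, M, fun j hj => ?_, fun j => ?_, ?_⟩
  · have hMT : Real.exp^[k] T ≤ M j := by
      rw [← hexpm]; exact Real.exp_le_exp.2 (by linarith [(Nat.cast_nonneg j : (0 : ℝ) ≤ j)])
    have hMj : Real.exp j ≤ M j := Real.exp_le_exp.2 (by linarith)
    have hME : E ≤ M j := (exp_iterate_mono k hTN).trans hMT
    have hy0 : 0 < y j := by positivity
    have hbump := one_le_logBump hN hME
    have hkap := kappa_sq_mul_rpow_le hk hN hTN hMT hMj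
    refine ⟨hy0, hME, ?_, ?_⟩
    · have h1 : (D * θ ^ 2 * kappa k N j ^ 2) * E ^ 4 ≤ logBump k N (M j) * E ^ 4 := by
        nlinarith [sq_nonneg (kappa k N j)]
      exact le_of_mul_le_mul_right h1 (by positivity)
    · have h1 : kappa k N j ^ 2 ≤ E ^ 4 * logBump k N (M j) :=
        (le_mul_of_one_le_right (sq_nonneg _) (Real.one_le_rpow hT1 hN1.le)).trans hkap
      have h2 := hCb _ hME
      have hM0 : 0 < M j := Real.exp_pos _
      calc D * M j * logBump k N (M j) * kappa k N j ^ 2 * y j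
          ≤ D * M j * (C * M j) * (E ^ 4 * (C * M j)) * y j := by
            have h3 : kappa k N j ^ 2 ≤ E ^ 4 * (C * M j) := h1.trans (by gcongr)
            gcongr
        _ = D * E ^ 4 * C ^ 2 * (M j ^ 3 * y j) := by ring
        _ = D * E ^ 4 * C ^ 2 * (Q⁻¹ * Real.exp 3) := by
            congr 1
            simp only [hM, hy]
            rw [← Real.exp_nat_mul, mul_assoc Q⁻¹, ← Real.exp_add, mul_left_comm, ← Real.exp_add]
            congr 2
            push_cast
            ring
        _ = Q * Q⁻¹ := by rw [hQ]; ring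
        _ = 1 := mul_inv_cancel₀ hQ0.ne'
        _ ≤ 1 := le_rfl
  · simp only [hy]
    rw [mul_left_comm, ← Real.exp_add]
    congr 2
    push_cast
    ring
  -- As `1 / y_1 = Q exp(3m)` and `3 exp^(k-1)(T) ≤ exp^(k-1)(3T)`, the choice `C₁ = √Q`, `C₂ = 3
  -- cT` works.
  · have h3 : Real.exp (3 * m) ≤ Real.exp^[k] (3 * cT * θ ^ (2 / (N - 1))) := by
      have : 3 * cT * θ ^ (2 / (N - 1)) = 3 * T := by rw [hT]; ring
      rw [this]
      conv_rhs => rw [← Nat.sub_add_cancel hk, Function.iterate_succ_apply']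
      exact Real.exp_le_exp.2 (three_mul_exp_iterate_le hT1 _)
    rw [mul_pow, Real.sq_sqrt hQ0.le, ← Real.rpow_mul_natCast ((Real.exp_pos _).le.trans h3)]
    simp only [hy]
    norm_num
    calc (1 : ℝ) = Q * Real.exp (3 * m) * (Q⁻¹ * Real.exp (-(3 * m))) := by
          rw [Real.exp_neg]
          field_simp
      _ ≤ _ := by gcongr

/-- Where `t² ≥ M`, monotonicity of the bump gives the bound; elsewhere the left side is
nonpositive. The freedom in `M` replaces all duality for the Young function. -/
lemma logBump_mul_sub_le_youngPhi (hN : 1 < N) {M : ℝ} (hM : threshold k N ≤ M) (t : ℝ) :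
    logBump k N M * (t ^ 2 - M) ≤ youngPhi k N t := by
  have hM1 := one_le_logBump hN hM
  have hM0 := two_le_threshold (k := k) hN
  unfold youngPhi
  by_cases ht : M ≤ t ^ 2
  · rw [if_pos (hM.trans ht)]
    have := logBump_mono hN hM ht
    nlinarith [sq_nonneg t]
  · have h1 : logBump k N M * (t ^ 2 - M) ≤ 0 :=
      mul_nonpos_of_nonneg_of_nonpos (by linarith) (by linarith)
    refine h1.trans ?_
    split_ifs with h
    · exact mul_nonneg (sq_nonneg _) (zero_le_one.trans (one_le_logBump hN h))
    · exact mul_nonneg (sq_nonneg _) (zero_le_one.trans (one_le_logBump hN le_rfl))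

end DegenerateDG

namespace DegenerateDG

/-! ### Lipschitz functions with compact support -/

variable {n : ℕ}

/-- Rademacher's theorem on a neighbourhood of each point; locally null sets are null. -/
lemma ae_differentiableAt_of_locallyLipschitzOn {Ω : Set (𝔼 n)} (hΩ : IsOpen Ω) {f : 𝔼 n → ℝ}
    (hf : LocallyLipschitzOn Ω f) : ∀ᵐ x ∂volume.restrict Ω, DifferentiableAt ℝ f x := by
  rw [ae_restrict_iff' hΩ.measurableSet, ae_iff]
  refine measure_null_of_locally_null _ fun x hx => ?_
  simp only [Classical.not_imp, Set.mem_ofPred_eq] at hx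
  obtain ⟨K, t, ht, hK⟩ := hf hx.1
  rw [hΩ.nhdsWithin_eq hx.1] at ht
  refine ⟨{y | y ∈ interior t ∧ ¬ DifferentiableAt ℝ f y}, ?_, ?_⟩
  · filter_upwards [self_mem_nhdsWithin, mem_nhdsWithin_of_mem_nhds (interior_mem_nhds.2 ht)]
      with y hy hyt
    simp only [Classical.not_imp] at hy
    exact ⟨hyt, hy.2⟩
  · have h := (hK.mono interior_subset).ae_differentiableWithinAt_of_mem (μ := volume)
    rw [ae_iff] at h
    refine measure_mono_null (fun y hy => ?_) h
    simp only [Set.mem_ofPred_eq, Classical.not_imp]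
    exact ⟨hy.1, fun hd => hy.2 (hd.differentiableAt (isOpen_interior.mem_nhds hy.1))⟩

/-- On a closed ball exceeding the support by distance `1` a Lipschitz constant exists by
compactness. A point of the support and a point outside that ball are at distance at least `1`, so
there the supremum of `|v|` serves as a constant. -/
lemma exists_lipschitzWith_of_hasCompactSupport {v : 𝔼 n → ℝ} (hv : LocallyLipschitz v)
    (hc : HasCompactSupport v) : ∃ K : ℝ≥0, LipschitzWith K v := by
  obtain ⟨C, hC⟩ := hc.exists_bound_of_continuous hv.continuous
  obtain ⟨ρ, hρ⟩ := hc.isCompact.isBounded.subset_closedBall 0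
  obtain ⟨K, hK⟩ := ((locallyLipschitzOn_univ.2 hv).mono
    (Set.subset_univ _)).exists_lipschitzOnWith_of_compact (isCompact_closedBall (0 : 𝔼 n) (ρ + 1))
  have hC0 : 0 ≤ C := (norm_nonneg _).trans (hC 0)
  have key : ∀ x y, x ∈ Metric.closedBall (0 : 𝔼 n) (ρ + 1) →
      y ∉ Metric.closedBall (0 : 𝔼 n) (ρ + 1) →
      dist (v x) (v y) ≤ max (K : ℝ) C * dist x y := by
    intro x y _ hy
    have hvy : v y = 0 := by
      refine image_eq_zero_of_notMem_tsupport fun h => hy ?_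
      exact Metric.closedBall_subset_closedBall (by linarith) (hρ h)
    by_cases hx : x ∈ tsupport v
    · have h1 : 1 ≤ dist x y := by
        have h2 := hρ hx
        rw [mem_closedBall_zero_iff] at h2 hy
        have := norm_sub_norm_le y x
        rw [dist_eq_norm, norm_sub_rev]
        linarith
      rw [hvy, dist_zero_right]
      calc ‖v x‖ ≤ max (K : ℝ) C * 1 := by rw [mul_one]; exact (hC x).trans (le_max_right _ _)
        _ ≤ _ := by gcongr
    · rw [hvy, image_eq_zero_of_notMem_tsupport hx, dist_self]
      positivity
  refine ⟨Real.toNNReal (max (K : ℝ) C), LipschitzWith.of_dist_le_mul fun x y => ?_⟩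
  rw [Real.coe_toNNReal _ (by positivity)]
  by_cases hx : x ∈ Metric.closedBall (0 : 𝔼 n) (ρ + 1) <;>
    by_cases hy : y ∈ Metric.closedBall (0 : 𝔼 n) (ρ + 1)
  · refine (hK.dist_le_mul x hx y hy).trans ?_
    gcongr
    exact le_max_left _ _
  · exact key x y hx hy
  · rw [dist_comm, dist_comm x]; exact key y x hy hx
  · have h0 : ∀ z, z ∉ Metric.closedBall (0 : 𝔼 n) (ρ + 1) → v z = 0 := fun z hz =>
      image_eq_zero_of_notMem_tsupport fun h =>
        hz (Metric.closedBall_subset_closedBall (by linarith) (hρ h))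
    rw [h0 x hx, h0 y hy, dist_self]
    positivity

lemma locallyLipschitzOn_mul {Ω : Set (𝔼 n)} {f g : 𝔼 n → ℝ}
    (hf : LocallyLipschitzOn Ω f) (hg : LocallyLipschitzOn Ω g) :
    LocallyLipschitzOn Ω fun x => f x * g x := by
  intro x hx
  obtain ⟨K, s, hs, hK⟩ := hf hx
  obtain ⟨L, t, ht, hL⟩ := hg hx
  have hfc : ∀ᶠ y in 𝓝[Ω] x, ‖f y‖ < ‖f x‖ + 1 :=
    (hf.continuousOn x hx).norm.eventually_lt_const (by linarith)
  have hgc : ∀ᶠ y in 𝓝[Ω] x, ‖g y‖ < ‖g x‖ + 1 :=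
    (hg.continuousOn x hx).norm.eventually_lt_const (by linarith)
  refine ⟨Real.toNNReal ((‖f x‖ + 1) * L + K * (‖g x‖ + 1)),
    {y | y ∈ s ∧ y ∈ t ∧ ‖f y‖ < ‖f x‖ + 1 ∧ ‖g y‖ < ‖g x‖ + 1}, ?_,
    LipschitzOnWith.of_dist_le_mul fun y hy z hz => ?_⟩
  · filter_upwards [hs, ht, hfc, hgc] with y h1 h2 h3 h4 using ⟨h1, h2, h3, h4⟩
  · have h1 := hK.dist_le_mul y hy.1 z hz.1
    have h2 := hL.dist_le_mul y hy.2.1 z hz.2.1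
    rw [Real.coe_toNNReal _ (by positivity)]
    rw [dist_eq_norm] at h1 h2 ⊢
    have h3 : f y * g y - f z * g z = f y * (g y - g z) + (f y - f z) * g z := by ring
    rw [h3]
    calc _ ≤ ‖f y‖ * ‖g y - g z‖ + ‖f y - f z‖ * ‖g z‖ := by
          refine (norm_add_le _ _).trans ?_
          rw [norm_mul, norm_mul]
      _ ≤ (‖f x‖ + 1) * (L * dist y z) + (K * dist y z) * (‖g x‖ + 1) := by
          have := hy.2.2.1
          have := hz.2.2.2
          gcongr
      _ = _ := by ring

lemma locallyLipschitzOn_posPart {Ω : Set (𝔼 n)} {f : 𝔼 n → ℝ} (hf : LocallyLipschitzOn Ω f)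
    (l : ℝ) : LocallyLipschitzOn Ω fun x => max (f x - l) 0 := by
  intro x hx
  obtain ⟨K, s, hs, hK⟩ := hf hx
  refine ⟨K, s, hs, LipschitzOnWith.of_dist_le_mul fun y hy z hz => ?_⟩
  refine le_trans ?_ (hK.dist_le_mul y hy z hz)
  rw [Real.dist_eq, Real.dist_eq]
  refine (abs_max_sub_max_le_abs _ _ _).trans (le_of_eq ?_)
  ring_nf

lemma IsLipC.mono {S U : Set (𝔼 n)} {v : 𝔼 n → ℝ} (h : IsLipC S v) (hSU : S ⊆ U) : IsLipC U v :=
  ⟨h.1, h.2.1, h.2.2.trans hSU⟩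

lemma IsLipC.locallyLipschitz {S : Set (𝔼 n)} {v : 𝔼 n → ℝ} (h : IsLipC S v) :
    LocallyLipschitz v :=
  h.1.choose_spec.locallyLipschitz

lemma IsLipC.eq_zero {S : Set (𝔼 n)} {v : 𝔼 n → ℝ} (h : IsLipC S v) {x : 𝔼 n} (hx : x ∉ S) :
    v x = 0 :=
  image_eq_zero_of_notMem_tsupport fun hx' => hx (h.2.2 hx')

lemma gradient_eq_zero_of_notMem_tsupport {v : 𝔼 n → ℝ} {x : 𝔼 n} (hx : x ∉ tsupport v) :
    gradient v x = 0 := by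
  have : fderiv ℝ v x = 0 :=
    image_eq_zero_of_notMem_tsupport fun h => hx (tsupport_fderiv_subset ℝ h)
  simp [gradient, this]

lemma IsLipC.gradient_eq_zero {S : Set (𝔼 n)} {v : 𝔼 n → ℝ} (h : IsLipC S v) {x : 𝔼 n}
    (hx : x ∉ S) : gradient v x = 0 :=
  gradient_eq_zero_of_notMem_tsupport fun hx' => hx (h.2.2 hx')

lemma IsLipC.ae_differentiableAt {S : Set (𝔼 n)} {v : 𝔼 n → ℝ} (h : IsLipC S v) :
    ∀ᵐ x ∂(volume : Measure (𝔼 n)), DifferentiableAt ℝ v x :=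
  h.1.choose_spec.ae_differentiableAt

lemma IsLipC.exists_norm_le {S : Set (𝔼 n)} {v : 𝔼 n → ℝ} (h : IsLipC S v) :
    ∃ C : ℝ, 0 < C ∧ (∀ x, ‖v x‖ ≤ C) ∧ ∀ x, ‖gradient v x‖ ≤ C := by
  obtain ⟨K, hK⟩ := h.1
  obtain ⟨C, hC⟩ := h.2.1.exists_bound_of_continuous hK.continuous
  refine ⟨max (max C K) 1, by positivity, fun x => (hC x).trans (by simp), fun x => ?_⟩
  have : ‖gradient v x‖ ≤ K := by
    simp only [gradient, LinearIsometryEquiv.norm_map]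
    exact norm_fderiv_le_of_lipschitz ℝ hK
  exact this.trans (by simp)

/-- The product of a Lipschitz function with compact support in `S ⊆ Ω` and a locally Lipschitz
function on `Ω`. -/
lemma IsLipC.mul_locallyLipschitzOn {Ω S : Set (𝔼 n)} (hΩ : IsOpen Ω) (hS : S ⊆ Ω)
    {η p : 𝔼 n → ℝ} (hη : IsLipC S η) (hp : LocallyLipschitzOn Ω p) :
    IsLipC S fun x => η x * p x := by
  have hsub : tsupport (fun x => η x * p x) ⊆ tsupport η := tsupport_mul_subset_left
  have hcs : HasCompactSupport fun x => η x * p x := hη.2.1.mul_right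
  refine ⟨exists_lipschitzWith_of_hasCompactSupport ?_ hcs, hcs, hsub.trans hη.2.2⟩
  intro x
  by_cases hx : x ∈ Ω
  · obtain ⟨K, t, ht, h⟩ := locallyLipschitzOn_mul
      ((locallyLipschitzOn_univ.2 hη.locallyLipschitz).mono (Set.subset_univ _)) hp hx
    exact ⟨K, t, by rwa [hΩ.nhdsWithin_eq hx] at ht, h⟩
  · have hx' : x ∉ tsupport η := fun h => hx (hS (hη.2.2 h))
    refine ⟨0, (tsupport η)ᶜ, (isClosed_tsupport η).isOpen_compl.mem_nhds hx',
      LipschitzOnWith.of_dist_le_mul fun y hy z hz => ?_⟩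
    simp [image_eq_zero_of_notMem_tsupport hy, image_eq_zero_of_notMem_tsupport hz]

/-! ### Gradients of truncations and products. -/

lemma gradient_eq_zero_of_isLocalMin {f : 𝔼 n → ℝ} {x : 𝔼 n} (h : IsLocalMin f x) :
    gradient f x = 0 := by
  simp [gradient, h.fderiv_eq_zero]

lemma gradient_eq_zero_of_isLocalMax {f : 𝔼 n → ℝ} {x : 𝔼 n} (h : IsLocalMax f x) :
    gradient f x = 0 := by
  simp [gradient, h.fderiv_eq_zero]

lemma gradient_congr {f g : 𝔼 n → ℝ} {x : 𝔼 n} (h : f =ᶠ[𝓝 x] g) :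
    gradient f x = gradient g x := by
  simp [gradient, h.fderiv_eq]

/-- Where `f x ≤ l` the truncation attains its minimum, so its gradient is zero, by Fermat's rule or
by the default value at a kink. Differentiability of `f` is therefore not required. -/
lemma gradient_posPart {f : 𝔼 n → ℝ} {x : 𝔼 n} (hf : ContinuousAt f x) (l : ℝ) :
    gradient (fun y => max (f y - l) 0) x = if l < f x then gradient f x else 0 := by
  split_ifs with h
  · have : (fun y => max (f y - l) 0) =ᶠ[𝓝 x] fun y => f y - l := by
      filter_upwards [hf.eventually_const_lt h] with y hy
      exact max_eq_left (by linarith)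
    rw [gradient_congr this]
    simp [gradient, fderiv_sub_const]
  · refine gradient_eq_zero_of_isLocalMin (Eventually.of_forall fun y => ?_)
    simp only
    rw [max_eq_right (show f x - l ≤ 0 by linarith)]
    exact le_max_right _ _

/-- Truncation of a cutoff function to values in `[0, 1]`. -/
lemma IsLipC.exists_truncation {S : Set (𝔼 n)} {ψ : 𝔼 n → ℝ} (hψ : IsLipC S ψ) :
    ∃ η : 𝔼 n → ℝ, IsLipC S η ∧ (∀ x, 0 ≤ η x) ∧ (∀ x, η x ≤ 1) ∧ (∀ x, ψ x = 1 → η x = 1) ∧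
      ∀ x, gradient η x = 0 ∨ gradient η x = gradient ψ x := by
  obtain ⟨K, hK⟩ := hψ.1
  have hsub : tsupport (fun x => min (max (ψ x) 0) 1) ⊆ tsupport ψ := by
    refine closure_mono fun x hx => ?_
    simp only [Function.mem_support] at hx ⊢
    contrapose! hx
    simp [hx]
  refine ⟨fun x => min (max (ψ x) 0) 1, ⟨⟨K, ?_⟩, ?_, hsub.trans hψ.2.2⟩, fun x => by positivity,
    fun x => min_le_right _ _, fun x hx => by simp [hx], fun x => ?_⟩
  · exact (hK.max_const 0).min_const 1
  · exact HasCompactSupport.of_support_subset_isCompact hψ.2.1 (subset_closure.trans hsub)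
  -- Where `ψ ≤ 0` or `ψ ≥ 1` the truncation is at an extremum and its gradient is zero, kinks
  -- included; elsewhere it coincides with `ψ` nearby.
  · have hc : ContinuousAt ψ x := hK.continuous.continuousAt
    rcases le_or_gt (ψ x) 0 with h0 | h0
    · left
      refine gradient_eq_zero_of_isLocalMin (Eventually.of_forall fun y => ?_)
      simp only
      rw [max_eq_right h0, min_eq_left zero_le_one]
      positivity
    · rcases le_or_gt 1 (ψ x) with h1 | h1
      · left
        refine gradient_eq_zero_of_isLocalMax (Eventually.of_forall fun y => ?_)
        simp only
        rw [max_eq_left h0.le, min_eq_right h1]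
        exact min_le_right _ _
      · right
        refine gradient_congr ?_
        filter_upwards [hc.eventually_const_lt h0, hc.eventually_lt_const h1] with y h2 h3
        rw [max_eq_left h2.le, min_eq_left h3.le]

lemma gradient_mul {f g : 𝔼 n → ℝ} {x : 𝔼 n} (hf : DifferentiableAt ℝ f x)
    (hg : DifferentiableAt ℝ g x) :
    gradient (fun y => f y * g y) x = f x • gradient g x + g x • gradient f x := by
  have h := fderiv_fun_mul hf hg
  simp [gradient, h]

lemma measurable_gradient (f : 𝔼 n → ℝ) : Measurable (gradient f) :=
  (InnerProductSpace.toDual ℝ (𝔼 n)).symm.continuous.measurable.comp (measurable_fderiv ℝ f)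

end DegenerateDG

namespace DegenerateDG

/-! ### The degenerate Sobolev spaces -/

lemma eLpNorm_two_sq {X F : Type*} [MeasurableSpace X] [NormedAddCommGroup F] (μ : Measure X)
    (f : X → F) : eLpNorm f 2 μ ^ 2 = ∫⁻ x, ENNReal.ofReal (‖f x‖ ^ 2) ∂μ := by
  have h := eLpNorm_nnreal_pow_eq_lintegral (f := f) (μ := μ) (p := 2) (by norm_num)
  have h2 : ∀ x, ENNReal.ofReal (‖f x‖ ^ 2) = ‖f x‖ₑ ^ (((2 : ℝ≥0) : ℝ)) := fun x => by
    rw [ENNReal.ofReal_pow (norm_nonneg _), ofReal_norm]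
    norm_num
  simp_rw [h2, ← h]
  norm_num

lemma tendsto_zero_of_sq_tendsto_zero {ι : Type*} {L : Filter ι} {a : ι → ℝ≥0∞}
    (h : Tendsto (fun i => a i ^ 2) L (𝓝 0)) : Tendsto a L (𝓝 0) := by
  have h1 := (ENNReal.continuous_rpow_const (y := (1 / 2 : ℝ))).tendsto 0 |>.comp h
  have h2 : ((fun x : ℝ≥0∞ => x ^ (1 / 2 : ℝ)) ∘ fun i => a i ^ 2) = a := by
    funext i
    simp only [Function.comp]
    rw [← ENNReal.rpow_natCast, ← ENNReal.rpow_mul]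
    norm_num
  rw [h2] at h1
  simpa using h1

/-- The Heaviside function with its jump at `l`. -/
noncomputable def step (l t : ℝ) : ℝ := if l < t then 1 else 0

lemma measurable_step (l : ℝ) : Measurable (step l) :=
  Measurable.ite measurableSet_Ioi measurable_const measurable_const

lemma step_eq_or (l t : ℝ) : step l t = 0 ∨ step l t = 1 := by
  unfold step; split_ifs <;> simp

lemma tendsto_step {ι : Type*} {L : Filter ι} {l t : ℝ} {a : ι → ℝ} (ht : t ≠ l)
    (h : Tendsto a L (𝓝 t)) : Tendsto (fun i => step l (a i)) L (𝓝 (step l t)) := by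
  refine tendsto_const_nhds.congr' ?_
  rcases lt_or_gt_of_ne ht with h1 | h1
  · filter_upwards [h.eventually_lt_const h1] with i hi
    simp [step, not_lt.2 hi.le, not_lt.2 h1.le]
  · filter_upwards [h.eventually_const_lt h1] with i hi
    simp [step, hi, h1]

variable {n : ℕ} {Ω U S : Set (𝔼 n)} {A B : 𝔼 n → 𝔼 n →L[ℝ] 𝔼 n} {w : 𝔼 n → ℝ} {c C : ℝ}

lemma DegenerateStructure.exists_norm_le (h : DegenerateStructure Ω A B w c C) :
    ∃ K : ℝ, 0 < K ∧ ∀ x ∈ Ω, ‖B x‖ ≤ K := by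
  obtain ⟨L, hL⟩ := h.lipschitz
  obtain ⟨D, hD⟩ := Metric.isBounded_iff.1 h.bounded
  rcases Ω.eq_empty_or_nonempty with h0 | ⟨x₀, hx₀⟩
  · exact ⟨1, one_pos, fun x hx => by simp [h0] at hx⟩
  · have hD0 : 0 ≤ D := dist_nonneg.trans (hD hx₀ hx₀)
    refine ⟨‖B x₀‖ + L * D + 1, by positivity, fun x hx => ?_⟩
    have h1 := hL.dist_le_mul x hx x₀ hx₀
    rw [dist_eq_norm] at h1
    have h2 : (L : ℝ) * dist x x₀ ≤ L * D := by gcongr; exact hD hx hx₀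
    linarith [norm_le_norm_add_norm_sub' (B x) (B x₀)]

lemma DegenerateStructure.aestronglyMeasurable_apply (h : DegenerateStructure Ω A B w c C)
    (hU : U ⊆ Ω) {G : 𝔼 n → 𝔼 n} (hG : AEStronglyMeasurable G (volume.restrict U)) :
    AEStronglyMeasurable (fun x => B x (G x)) (volume.restrict U) := by
  obtain ⟨L, hL⟩ := h.lipschitz
  have hB : AEStronglyMeasurable B (volume.restrict U) :=
    (hL.continuousOn.aestronglyMeasurable h.isOpen.measurableSet).mono_measure
      (Measure.restrict_mono hU le_rfl)
  exact isBoundedBilinearMap_apply.continuous.comp_aestronglyMeasurable (hB.prodMk hG)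

lemma DegenerateStructure.ae_comparable (h : DegenerateStructure Ω A B w c C) (hU : U ⊆ Ω) :
    ∀ᵐ x ∂volume.restrict U, ∀ ξ : 𝔼 n,
      c * inner ℝ ξ (A x ξ) ≤ ‖B x ξ‖ ^ 2 ∧ ‖B x ξ‖ ^ 2 ≤ C * inner ℝ ξ (A x ξ) :=
  ae_mono (Measure.restrict_mono hU le_rfl) h.comparable

lemma DegenerateStructure.mul_energy_le (h : DegenerateStructure Ω A B w c C) (hc : 0 < c)
    (hU : U ⊆ Ω) (G : 𝔼 n → 𝔼 n) :
    ENNReal.ofReal c * energy A U G ≤ eLpNorm (fun x => B x (G x)) 2 (volume.restrict U) ^ 2 := by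
  rw [eLpNorm_two_sq, energy, ← lintegral_const_mul' _ _ ENNReal.ofReal_ne_top]
  refine lintegral_mono_ae ?_
  filter_upwards [h.ae_comparable hU] with x hx
  rw [← ENNReal.ofReal_mul hc.le]
  exact ENNReal.ofReal_le_ofReal (hx _).1

lemma DegenerateStructure.sq_eLpNorm_le (h : DegenerateStructure Ω A B w c C) (hC : 0 < C)
    (hU : U ⊆ Ω) (G : 𝔼 n → 𝔼 n) :
    eLpNorm (fun x => B x (G x)) 2 (volume.restrict U) ^ 2 ≤ ENNReal.ofReal C * energy A U G := by
  rw [eLpNorm_two_sq, energy, ← lintegral_const_mul' _ _ ENNReal.ofReal_ne_top]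
  refine lintegral_mono_ae ?_
  filter_upwards [h.ae_comparable hU] with x hx
  rw [← ENNReal.ofReal_mul hC.le]
  exact ENNReal.ofReal_le_ofReal (hx _).2

lemma DegenerateStructure.energy_lt_top (h : DegenerateStructure Ω A B w c C) (hc : 0 < c)
    (hU : U ⊆ Ω) {G : 𝔼 n → 𝔼 n}
    (hG : eLpNorm (fun x => B x (G x)) 2 (volume.restrict U) < ∞) : energy A U G < ∞ := by
  have h1 := (h.mul_energy_le hc hU G).trans_lt (ENNReal.pow_lt_top (n := 2) hG)
  by_contra h2
  rw [not_lt, top_le_iff] at h2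
  rw [h2, ENNReal.mul_top (by simpa using hc)] at h1
  exact lt_irrefl _ h1

lemma DegenerateStructure.eLpNorm_lt_top (h : DegenerateStructure Ω A B w c C) (hC : 0 < C)
    (hU : U ⊆ Ω) {G : 𝔼 n → 𝔼 n} (hG : energy A U G < ∞) :
    eLpNorm (fun x => B x (G x)) 2 (volume.restrict U) < ∞ := by
  have h1 := (h.sq_eLpNorm_le hC hU G).trans_lt (ENNReal.mul_lt_top ENNReal.ofReal_lt_top hG)
  simpa using h1

/-- Convergence in the degenerate seminorm becomes convergence of `B F` in an honest `L²` space,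
where the triangle inequality is available. -/
lemma DegenerateStructure.tendsto_energy_iff (h : DegenerateStructure Ω A B w c C) (hc : 0 < c)
    (hC : 0 < C) (hU : U ⊆ Ω) {F : ℕ → 𝔼 n → 𝔼 n} :
    Tendsto (fun m => energy A U (F m)) atTop (𝓝 0) ↔
      Tendsto (fun m => eLpNorm (fun x => B x (F m x)) 2 (volume.restrict U)) atTop (𝓝 0) := by
  constructor
  · intro hE
    refine tendsto_zero_of_sq_tendsto_zero ?_
    have h1 := ENNReal.Tendsto.const_mul (a := ENNReal.ofReal C) hE (Or.inr ENNReal.ofReal_ne_top)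
    rw [mul_zero] at h1
    exact tendsto_of_tendsto_of_tendsto_of_le_of_le tendsto_const_nhds h1 (fun _ => zero_le)
      fun m => h.sq_eLpNorm_le hC hU (F m)
  · intro hE
    have h1 := ENNReal.Tendsto.const_mul (a := (ENNReal.ofReal c)⁻¹) (ENNReal.Tendsto.pow (n := 2) hE)
      (Or.inr (ENNReal.inv_ne_top.2 (by simpa using hc)))
    rw [zero_pow two_ne_zero, mul_zero] at h1
    refine tendsto_of_tendsto_of_tendsto_of_le_of_le tendsto_const_nhds h1 (fun _ => zero_le)
      fun m => ?_
    rw [mul_comm, ← div_eq_mul_inv, ENNReal.le_div_iff_mul_le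
      (Or.inl (by simpa using hc)) (Or.inl ENNReal.ofReal_ne_top), mul_comm]
    exact h.mul_energy_le hc hU (F m)

lemma eLpNorm_lt_top_of_le {X F F₁ F₂ : Type*} [MeasurableSpace X] [NormedAddCommGroup F]
    [NormedAddCommGroup F₁] [NormedAddCommGroup F₂] {μ : Measure X} {f : X → F} {g₁ : X → F₁}
    {g₂ : X → F₂} (h₁ : MemLp g₁ 2 μ) (h₂ : MemLp g₂ 2 μ) {a b : ℝ}
    (h : ∀ᵐ x ∂μ, ‖f x‖ ≤ a * ‖g₁ x‖ + b * ‖g₂ x‖) : eLpNorm f 2 μ < ∞ := by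
  have h3 : MemLp (fun x => a * ‖g₁ x‖ + b * ‖g₂ x‖) 2 μ :=
    (h₁.norm.const_mul a).add (h₂.norm.const_mul b)
  refine (eLpNorm_mono_ae ?_).trans_lt h3.eLpNorm_lt_top
  filter_upwards [h] with x hx
  exact hx.trans (le_abs_self _)

lemma abs_posPart_sub_posPart_le (a b l : ℝ) : |max (a - l) 0 - max (b - l) 0| ≤ |a - b| := by
  refine (abs_max_sub_max_le_abs _ _ _).trans (le_of_eq ?_)
  ring_nf

lemma abs_posPart_le {l : ℝ} (hl : 0 ≤ l) (a : ℝ) : |max (a - l) 0| ≤ |a| := by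
  rw [abs_of_nonneg (le_max_right _ _)]
  exact max_le (by linarith [le_abs_self a]) (abs_nonneg a)

/-- The product of a cutoff function and of `(u - l)₊` belongs to `(W_A^{1,2})₀`, with the expected
gradient, if the level set `{u = l}` is a null set. -/
lemma MemW.memWZero_cutoff_mul_posPart (h : DegenerateStructure Ω A B w c C) (hc : 0 < c)
    (hC : 0 < C) {u : 𝔼 n → ℝ} {G : 𝔼 n → 𝔼 n} (hu : MemW A Ω u G) {l : ℝ} (hl : 0 ≤ l)
    (hlu : ∀ᵐ x ∂volume.restrict Ω, u x ≠ l) (hU : U ⊆ Ω)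
    {η : 𝔼 n → ℝ} (hη : IsLipC U η) :
    MemWZero A U (fun x => η x * max (u x - l) 0)
      (fun x => (η x * step l (u x)) • G x + max (u x - l) 0 • gradient η x) := by
  obtain ⟨f, hf, hu2, hGm, hGE, hL2, hEn⟩ := hu
  have hfm : ∀ m, AEStronglyMeasurable (f m) (volume.restrict Ω) := fun m =>
    (hf m).continuousOn.aestronglyMeasurable h.isOpen.measurableSet
  -- The step function is discontinuous, so `L²` convergence is not enough: an a.e. convergent
  -- subsequence is needed.
  obtain ⟨σ, hσ, hae⟩ := (tendstoInMeasure_of_tendsto_eLpNorm two_ne_zero hfm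
    hu2.aestronglyMeasurable hL2).exists_seq_tendsto_ae
  have hle : volume.restrict U ≤ volume.restrict Ω := Measure.restrict_mono hU le_rfl
  obtain ⟨K, hK0, hK⟩ := h.exists_norm_le
  obtain ⟨Cη, hCη0, hCη, hCη'⟩ := hη.exists_norm_le
  have huU : MemLp u 2 (volume.restrict U) := hu2.mono_measure hle
  have hGU : AEStronglyMeasurable G (volume.restrict U) := hGm.mono_measure hle
  have hBG : MemLp (fun x => B x (G x)) 2 (volume.restrict U) :=
    ⟨h.aestronglyMeasurable_apply hU hGU,
      (eLpNorm_mono_measure _ hle).trans_lt (h.eLpNorm_lt_top hC le_rfl hGE)⟩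
  have hmem : ∀ᵐ x ∂volume.restrict U, x ∈ Ω := by
    have := ae_restrict_mem (μ := volume) h.isOpen.measurableSet
    exact ae_mono hle this
  have hηm : AEStronglyMeasurable η (volume.restrict U) :=
    hη.locallyLipschitz.continuous.aestronglyMeasurable
  have hpm : ∀ {g : 𝔼 n → ℝ}, AEStronglyMeasurable g (volume.restrict U) →
      AEStronglyMeasurable (fun x => max (g x - l) 0) (volume.restrict U) := fun hg =>
    ((hg.aemeasurable.sub_const l).max aemeasurable_const).aestronglyMeasurable
  have hsm : ∀ {g : 𝔼 n → ℝ}, AEStronglyMeasurable g (volume.restrict U) →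
      AEStronglyMeasurable (fun x => step l (g x)) (volume.restrict U) := fun hg =>
    ((measurable_step l).comp_aemeasurable hg.aemeasurable).aestronglyMeasurable
  have hVm : AEStronglyMeasurable
      (fun x => (η x * step l (u x)) • G x + max (u x - l) 0 • gradient η x)
      (volume.restrict U) :=
    ((hηm.mul (hsm huU.1)).smul hGU).add
      ((hpm huU.1).smul (measurable_gradient η).aestronglyMeasurable)
  have hsub : Tendsto (fun m => eLpNorm (fun x => f (σ m) x - u x) 2 (volume.restrict U)) atTop
      (𝓝 0) :=
    tendsto_of_tendsto_of_tendsto_of_le_of_le tendsto_const_nhds (hL2.comp hσ.tendsto_atTop)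
      (fun _ => zero_le) fun m => eLpNorm_mono_measure _ hle
  have hstep : ∀ t, |step l t| ≤ 1 := fun t => by
    rcases step_eq_or l t with h | h <;> simp [h]
  refine ⟨fun m x => η x * max (f (σ m) x - l) 0, fun m => hη.mul_locallyLipschitzOn h.isOpen hU
    (locallyLipschitzOn_posPart (hf _) l), ⟨hηm.mul (hpm huU.1), ?_⟩, hVm, ?_, ?_, ?_⟩
  · refine eLpNorm_lt_top_of_le huU huU (a := Cη) (b := 0) (Eventually.of_forall fun x => ?_)
    rw [norm_mul, zero_mul, add_zero]
    exact mul_le_mul (hCη x) (abs_posPart_le hl _) (norm_nonneg _) hCη0.le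
  · refine h.energy_lt_top hc hU (eLpNorm_lt_top_of_le hBG huU (a := Cη) (b := K * Cη) ?_)
    filter_upwards [hmem] with x hx
    rw [map_add, map_smul, map_smul]
    refine (norm_add_le _ _).trans (add_le_add ?_ ?_)
    · rw [norm_smul, norm_mul]
      refine mul_le_mul_of_nonneg_right ?_ (norm_nonneg _)
      calc ‖η x‖ * ‖step l (u x)‖ ≤ Cη * 1 :=
            mul_le_mul (hCη x) (hstep _) (norm_nonneg _) hCη0.le
        _ = Cη := mul_one _
    · rw [norm_smul, mul_comm]
      refine mul_le_mul ?_ (abs_posPart_le hl _) (norm_nonneg _) (by positivity)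
      exact ((B x).le_opNorm _).trans
        (mul_le_mul (hK x hx) (hCη' x) (norm_nonneg _) hK0.le)
  · have h1 := ENNReal.Tendsto.const_mul (a := ENNReal.ofReal Cη) hsub
      (Or.inr ENNReal.ofReal_ne_top)
    rw [mul_zero] at h1
    refine tendsto_of_tendsto_of_tendsto_of_le_of_le tendsto_const_nhds h1 (fun _ => zero_le)
      fun m => ?_
    refine eLpNorm_le_mul_eLpNorm_of_ae_le_mul (Eventually.of_forall fun x => ?_) 2
    rw [← mul_sub, norm_mul]
    exact mul_le_mul (hCη x) (abs_posPart_sub_posPart_le _ _ _) (norm_nonneg _) hCη0.le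
  · rw [h.tendsto_energy_iff hc hC hU]
    have hBf : Tendsto (fun m => eLpNorm (fun x => B x (gradient (f (σ m)) x - G x)) 2
        (volume.restrict U)) atTop (𝓝 0) :=
      tendsto_of_tendsto_of_tendsto_of_le_of_le tendsto_const_nhds
        (((h.tendsto_energy_iff hc hC le_rfl).1 hEn).comp hσ.tendsto_atTop)
        (fun _ => zero_le) fun m => eLpNorm_mono_measure _ hle
    have hfU : ∀ m, AEStronglyMeasurable (f m) (volume.restrict U) := fun m =>
      (hfm m).mono_measure hle
    -- The error from the jump of the step function. It tends to `0` by dominated convergence,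
    -- pointwise because `u ≠ l` a.e.; this avoids proving that the field `G` is degenerate on `{u =
    -- l}`.
    set D : ℕ → 𝔼 n → 𝔼 n := fun m x => (step l (f (σ m) x) - step l (u x)) • B x (G x) with hD
    have hDm : ∀ m, AEStronglyMeasurable (D m) (volume.restrict U) := fun m =>
      ((hsm (hfU _)).sub (hsm huU.1)).smul hBG.1
    have hDt : Tendsto (fun m => eLpNorm (D m) 2 (volume.restrict U)) atTop (𝓝 0) := by
      refine tendsto_zero_of_sq_tendsto_zero ?_
      simp_rw [eLpNorm_two_sq]
      have h0 : (0 : ℝ≥0∞) = ∫⁻ x, (fun _ => 0) x ∂volume.restrict U := by simp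
      rw [h0]
      refine tendsto_lintegral_of_dominated_convergence'
        (fun x => ENNReal.ofReal (‖B x (G x)‖ ^ 2))
        (fun m => ((hDm m).norm.aemeasurable.pow_const 2).ennreal_ofReal)
        (fun m => Eventually.of_forall fun x => ?_) ?_ ?_
      · refine ENNReal.ofReal_le_ofReal (pow_le_pow_left₀ (norm_nonneg _) ?_ 2)
        rw [hD, norm_smul]
        refine mul_le_of_le_one_left (norm_nonneg _) ?_
        rw [Real.norm_eq_abs]
        rcases step_eq_or l (f (σ m) x) with h | h <;> rcases step_eq_or l (u x) with h' | h' <;>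
          simp [h, h']
      · rw [← eLpNorm_two_sq]
        exact (ENNReal.pow_lt_top hBG.2).ne
      · filter_upwards [ae_mono hle hae, ae_mono hle hlu] with x hx hx'
        have h1 : Tendsto (fun m => D m x) atTop (𝓝 0) := by
          have := ((tendsto_step hx' hx).sub_const (step l (u x))).smul_const (B x (G x))
          simpa using this
        have h2 := ENNReal.tendsto_ofReal (h1.norm.pow 2)
        simpa using h2
    have hsum : Tendsto (fun m =>
        ENNReal.ofReal Cη * eLpNorm (fun x => B x (gradient (f (σ m)) x - G x)) 2
          (volume.restrict U) + ENNReal.ofReal Cη * eLpNorm (D m) 2 (volume.restrict U) +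
        ENNReal.ofReal (K * Cη) * eLpNorm (fun x => f (σ m) x - u x) 2 (volume.restrict U)) atTop
        (𝓝 0) := by
      have h1 := ENNReal.Tendsto.const_mul (a := ENNReal.ofReal Cη) hBf
        (Or.inr ENNReal.ofReal_ne_top)
      have h2 := ENNReal.Tendsto.const_mul (a := ENNReal.ofReal Cη) hDt
        (Or.inr ENNReal.ofReal_ne_top)
      have h3 := ENNReal.Tendsto.const_mul (a := ENNReal.ofReal (K * Cη)) hsub
        (Or.inr ENNReal.ofReal_ne_top)
      simpa using (h1.add h2).add h3
    refine tendsto_of_tendsto_of_tendsto_of_le_of_le tendsto_const_nhds hsum (fun _ => zero_le)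
      fun m => ?_
    have hdiff := ae_differentiableAt_of_locallyLipschitzOn h.isOpen
      (locallyLipschitzOn_posPart (hf (σ m)) l)
    -- The difference of the gradients splits into the error in the gradient of `u`, the error in
    -- the step function, and the error in the truncation where the cutoff varies.
    set a₁ : 𝔼 n → 𝔼 n := fun x =>
      (η x * step l (f (σ m) x)) • B x (gradient (f (σ m)) x - G x) with ha₁
    set a₂ : 𝔼 n → 𝔼 n := fun x => η x • D m x with ha₂
    set a₃ : 𝔼 n → 𝔼 n := fun x =>
      (max (f (σ m) x - l) 0 - max (u x - l) 0) • B x (gradient η x) with ha₃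
    have heq : (fun x => B x (gradient (fun y => η y * max (f (σ m) y - l) 0) x -
        ((η x * step l (u x)) • G x + max (u x - l) 0 • gradient η x)))
        =ᵐ[volume.restrict U] (a₁ + a₂ + a₃) := by
      filter_upwards [hmem, ae_mono hle hdiff, ae_restrict_of_ae hη.ae_differentiableAt]
        with x hx hd hdη
      have hcont : ContinuousAt (f (σ m)) x :=
        (hf (σ m)).continuousOn.continuousAt (h.isOpen.mem_nhds hx)
      rw [gradient_mul hdη hd, gradient_posPart hcont]
      have : (if l < f (σ m) x then gradient (f (σ m)) x else 0) =
          step l (f (σ m) x) • gradient (f (σ m)) x := by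
        unfold step; split_ifs <;> simp
      rw [this]
      simp only [ha₁, ha₂, ha₃, hD, Pi.add_apply, map_sub, map_add, map_smul]
      module
    rw [eLpNorm_congr_ae heq]
    have hm₁ : AEStronglyMeasurable a₁ (volume.restrict U) :=
      (hηm.mul (hsm (hfU _))).smul (h.aestronglyMeasurable_apply hU
        ((measurable_gradient _).aestronglyMeasurable.sub hGU))
    have hm₂ : AEStronglyMeasurable a₂ (volume.restrict U) := hηm.smul (hDm m)
    have hm₃ : AEStronglyMeasurable a₃ (volume.restrict U) :=
      ((hpm (hfU _)).sub (hpm huU.1)).smul (h.aestronglyMeasurable_apply hU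
        (measurable_gradient _).aestronglyMeasurable)
    refine (eLpNorm_add_le (hm₁.add hm₂) hm₃ one_le_two).trans (add_le_add
      ((eLpNorm_add_le hm₁ hm₂ one_le_two).trans (add_le_add ?_ ?_)) ?_)
    · refine eLpNorm_le_mul_eLpNorm_of_ae_le_mul (Eventually.of_forall fun x => ?_) 2
      rw [ha₁, norm_smul, norm_mul]
      refine mul_le_mul_of_nonneg_right ?_ (norm_nonneg _)
      calc ‖η x‖ * ‖step l (f (σ m) x)‖ ≤ Cη * 1 :=
            mul_le_mul (hCη x) (hstep _) (norm_nonneg _) hCη0.le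
        _ = Cη := mul_one _
    · refine eLpNorm_le_mul_eLpNorm_of_ae_le_mul (Eventually.of_forall fun x => ?_) 2
      rw [ha₂, norm_smul]
      exact mul_le_mul_of_nonneg_right (hCη x) (norm_nonneg _)
    · refine eLpNorm_le_mul_eLpNorm_of_ae_le_mul ?_ 2
      filter_upwards [hmem] with x hx
      rw [ha₃, norm_smul, mul_comm]
      refine mul_le_mul ?_ (abs_posPart_sub_posPart_le _ _ _) (norm_nonneg _) (by positivity)
      exact ((B x).le_opNorm _).trans
        (mul_le_mul (hK x hx) (hCη' x) (norm_nonneg _) hK0.le)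

/-! ### Consequences of the Orlicz–Sobolev inequality and of admissibility -/

lemma normMeasure_absolutelyContinuous (Ω : Set (𝔼 n)) (w : 𝔼 n → ℝ) (S : Set (𝔼 n)) :
    normMeasure Ω w S ≪ volume.restrict S := by
  refine Measure.AbsolutelyContinuous.trans Measure.smul_absolutelyContinuous ?_
  refine Measure.AbsolutelyContinuous.restrict ?_ S
  exact (withDensity_absolutelyContinuous _ _).trans Measure.restrict_le_self.absolutelyContinuous

/-- The minorant of `youngPhi` at `|v| / b`, integrated for some `b < a` with modular at most `1`.
The strict inequality yields such a `b` without attainment of the infimum. -/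
lemma lintegral_sq_sub_le_of_luxemburgNorm_lt {X : Type*} [MeasurableSpace X] {ν : Measure X}
    {k : ℕ} {N : ℝ} (hN : 1 < N) {v : X → ℝ} {a M : ℝ} (hM : threshold k N ≤ M)
    (hv : luxemburgNorm (youngPhi k N) ν v < ENNReal.ofReal a) :
    ∫⁻ y, ENNReal.ofReal (v y ^ 2 - a ^ 2 * M) ∂ν ≤ ENNReal.ofReal (a ^ 2 / logBump k N M) := by
  unfold luxemburgNorm at hv
  simp only [iInf_lt_iff] at hv
  obtain ⟨b, hb, hb1, hba⟩ := hv
  have hba' : b < a := (ENNReal.ofReal_lt_ofReal_iff_of_nonneg hb.le).1 hba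
  have hM0 : 0 ≤ M := by linarith [two_le_threshold (k := k) hN]
  have hbump : 0 < logBump k N M := one_pos.trans_le (one_le_logBump hN hM)
  calc ∫⁻ y, ENNReal.ofReal (v y ^ 2 - a ^ 2 * M) ∂ν
      ≤ ∫⁻ y, ENNReal.ofReal (a ^ 2 / logBump k N M) *
          ENNReal.ofReal (youngPhi k N (|v y| / b)) ∂ν := by
        refine lintegral_mono fun y => ?_
        rw [← ENNReal.ofReal_mul (by positivity)]
        rcases le_or_gt (v y ^ 2 - a ^ 2 * M) 0 with h0 | h0
        · rw [ENNReal.ofReal_of_nonpos h0]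
          exact zero_le
        refine ENNReal.ofReal_le_ofReal ?_
        have h1 := logBump_mul_sub_le_youngPhi hN hM (|v y| / b)
        have h2 : v y ^ 2 - a ^ 2 * M ≤ a ^ 2 * ((|v y| / b) ^ 2 - M) := by
          have h3 : v y ^ 2 ≤ a ^ 2 * (|v y| / b) ^ 2 := by
            rw [div_pow, sq_abs, mul_div_assoc', le_div_iff₀ (by positivity), mul_comm]
            gcongr
          nlinarith
        refine h2.trans ?_
        rw [div_mul_eq_mul_div, le_div_iff₀ hbump]
        nlinarith [sq_nonneg a]
    _ = ENNReal.ofReal (a ^ 2 / logBump k N M) *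
          ∫⁻ y, ENNReal.ofReal (youngPhi k N (|v y| / b)) ∂ν :=
        lintegral_const_mul' _ _ ENNReal.ofReal_ne_top
    _ ≤ _ := mul_le_of_le_one_right zero_le hb1

/-- The Orlicz–Sobolev inequality in `(W_A^{1,2})₀`, in the form in which it is used. -/
lemma MemWZero.lintegral_sq_sub_le (h : DegenerateStructure Ω A B w c C) (hc : 0 < c)
    (hC : 0 < C) {d : 𝔼 n → 𝔼 n → ℝ} {k : ℕ} {N : ℝ} (hN : 1 < N) {CS φr r : ℝ} {x : 𝔼 n}
    (hOS : OrliczSobolevOn Ω B w d (youngPhi k N) CS φr x r)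
    (hw : wMeasure Ω w (mball Ω d x r) ≠ 0)
    {v : 𝔼 n → ℝ} {V : 𝔼 n → 𝔼 n} (hv : MemWZero A (mball Ω d x r) v V) {a M : ℝ}
    (hM : threshold k N ≤ M)
    (ha : ENNReal.ofReal (CS * φr) * (wMeasure Ω w (mball Ω d x r)) ^ (-(1 / 2) : ℝ) *
      eLpNorm (fun y => B y (V y)) 2 (volume.restrict (mball Ω d x r)) < ENNReal.ofReal a) :
    ∫⁻ y, ENNReal.ofReal (v y ^ 2 - a ^ 2 * M) ∂normMeasure Ω w (mball Ω d x r) ≤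
      ENNReal.ofReal (a ^ 2 / logBump k N M) := by
  set S := mball Ω d x r with hS
  have hSΩ : S ⊆ Ω := fun y hy => hy.1
  obtain ⟨f, hf, hv2, hVm, hVE, hL2, hEn⟩ := hv
  have hfm : ∀ m, AEStronglyMeasurable (f m) (volume.restrict S) := fun m =>
    (hf m).locallyLipschitz.continuous.aestronglyMeasurable
  obtain ⟨σ, hσ, hae⟩ := (tendstoInMeasure_of_tendsto_eLpNorm two_ne_zero hfm
    hv2.aestronglyMeasurable hL2).exists_seq_tendsto_ae
  set q : ℝ≥0∞ := ENNReal.ofReal (CS * φr) * (wMeasure Ω w S) ^ (-(1 / 2) : ℝ) with hq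
  have hqtop : q ≠ ∞ :=
    ENNReal.mul_ne_top ENNReal.ofReal_ne_top (by simp [ENNReal.rpow_eq_top_iff, hw])
  have hlim : Tendsto (fun m => q * (eLpNorm (fun y => B y (V y)) 2 (volume.restrict S) +
      eLpNorm (fun y => B y (gradient (f m) y - V y)) 2 (volume.restrict S))) atTop
      (𝓝 (q * eLpNorm (fun y => B y (V y)) 2 (volume.restrict S))) := by
    have h1 := ((h.tendsto_energy_iff hc hC hSΩ).1 hEn).const_add
      (eLpNorm (fun y => B y (V y)) 2 (volume.restrict S))
    rw [add_zero] at h1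
    exact ENNReal.Tendsto.const_mul h1 (Or.inr hqtop)
  -- The strict bound by `a` passes from `V` to the Lipschitz approximants, for which the inequality
  -- is assumed; Fatou's lemma then returns to `v`.
  have hev : ∀ᶠ m in atTop, ∫⁻ y, ENNReal.ofReal (f m y ^ 2 - a ^ 2 * M) ∂normMeasure Ω w S ≤
      ENNReal.ofReal (a ^ 2 / logBump k N M) := by
    filter_upwards [hlim.eventually_lt_const ha] with m hm
    refine lintegral_sq_sub_le_of_luxemburgNorm_lt hN hM (lt_of_le_of_lt ?_ hm)
    refine (hOS (f m) (hf m)).trans (mul_le_mul_right ?_ q)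
    have heq : (fun y => B y (gradient (f m) y)) =
        (fun y => B y (V y)) + fun y => B y (gradient (f m) y - V y) := by
      funext y; simp
    rw [heq]
    exact eLpNorm_add_le (h.aestronglyMeasurable_apply hSΩ hVm)
      (h.aestronglyMeasurable_apply hSΩ
        ((measurable_gradient _).aestronglyMeasurable.sub hVm)) one_le_two
  have hac := normMeasure_absolutelyContinuous Ω w S
  calc ∫⁻ y, ENNReal.ofReal (v y ^ 2 - a ^ 2 * M) ∂normMeasure Ω w S
      ≤ ∫⁻ y, liminf (fun m => ENNReal.ofReal (f (σ m) y ^ 2 - a ^ 2 * M)) atTop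
          ∂normMeasure Ω w S := by
        refine lintegral_mono_ae (hac.ae_le ?_)
        filter_upwards [hae] with y hy
        exact (ENNReal.tendsto_ofReal ((hy.pow 2).sub_const _)).liminf_eq.ge
    _ ≤ liminf (fun m => ∫⁻ y, ENNReal.ofReal (f (σ m) y ^ 2 - a ^ 2 * M) ∂normMeasure Ω w S)
          atTop := lintegral_liminf_le' fun m =>
        (((hfm (σ m)).aemeasurable.mono_ac hac).pow_const 2 |>.sub_const _).ennreal_ofReal
    _ ≤ _ := liminf_le_of_frequently_le' (hσ.tendsto_atTop.eventually hev).frequently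

lemma wMeasure_restrict_absolutelyContinuous (h : DegenerateStructure Ω A B w c C) :
    volume.restrict Ω ≪ wMeasure Ω w := by
  refine withDensity_absolutelyContinuous' h.aemeasurable_weight.ennreal_ofReal ?_
  filter_upwards [h.weight_pos] with x hx
  simpa using hx

/-- Clears the denominators in `xNorm`; the work lies in the values `0` and `∞` of the extended
quotient. -/
lemma ofReal_abs_integral_le_xNorm (h : DegenerateStructure Ω A B w c C) (hC : 0 < C)
    (hS : S ⊆ Ω) (hSm : MeasurableSet S)
    (hw : wMeasure Ω w S < ∞) {f : 𝔼 n → ℝ} (hf : xNorm Ω A B w S f < ∞)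
    {v : 𝔼 n → ℝ} {V : 𝔼 n → 𝔼 n} (hv : MemWZero A S v V) :
    ENNReal.ofReal |∫ y in S, v y * f y| ≤ xNorm Ω A B w S f *
      (wMeasure Ω w {y | y ∈ S ∧ v y ≠ 0}) ^ (1 / 2 : ℝ) *
        eLpNorm (fun y => B y (V y)) 2 (volume.restrict S) := by
  set m := wMeasure Ω w {y | y ∈ S ∧ v y ≠ 0} with hm
  set p := ENNReal.ofReal |∫ y in S, v y * f y| with hp
  set q := eLpNorm (fun y => B y (V y)) 2 (volume.restrict S) with hq
  have hle : m ^ (-(1 / 2) : ℝ) * p / q ≤ xNorm Ω A B w S f := by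
    unfold xNorm
    exact le_iSup_of_le v (le_iSup_of_le V (le_iSup_of_le hv le_rfl))
  have hmtop : m ≠ ∞ := ((measure_mono fun y hy => hy.1).trans_lt hw).ne
  have hqtop : q ≠ ∞ := by
    obtain ⟨g, _, _, _, hVE, _, _⟩ := hv
    exact (h.eLpNorm_lt_top hC hS hVE).ne
  rcases eq_or_ne p 0 with hp0 | hp0
  · rw [hp0]; exact zero_le
  -- If `v` vanishes `w`-a.e. on `S`, it vanishes a.e., because `w > 0`; then the integral is zero.
  have hm0 : m ≠ 0 := by
    intro h0
    refine hp0 ?_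
    have h1 : ∀ᵐ y ∂volume.restrict S, v y * f y = 0 := by
      have h2 : ∀ᵐ y ∂wMeasure Ω w, ¬ (y ∈ S ∧ v y ≠ 0) := by
        rw [ae_iff]; simpa using h0
      have h3 := ae_mono (Measure.restrict_mono hS le_rfl)
        ((wMeasure_restrict_absolutelyContinuous h).ae_le h2)
      filter_upwards [h3, ae_restrict_mem hSm] with y hy hyS
      have : v y = 0 := by by_contra h4; exact hy ⟨hyS, h4⟩
      simp [this]
    rw [hp, integral_congr_ae h1]
    simp
  have hmr : m ^ (-(1 / 2) : ℝ) ≠ 0 := by simp [ENNReal.rpow_eq_zero_iff, hm0, hmtop]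
  -- A zero gradient norm with a nonzero integral would make the quotient infinite.
  have hq0 : q ≠ 0 := by
    intro h0
    rw [h0, ENNReal.div_zero (mul_ne_zero hmr hp0), top_le_iff] at hle
    exact hf.ne hle
  have hmm : m ^ (-(1 / 2) : ℝ) * m ^ (1 / 2 : ℝ) = 1 := by
    rw [← ENNReal.rpow_add _ _ hm0 hmtop]; norm_num
  rw [ENNReal.div_le_iff hq0 hqtop] at hle
  calc p = m ^ (1 / 2 : ℝ) * (m ^ (-(1 / 2) : ℝ) * p) := by
        rw [← mul_assoc, mul_comm (m ^ (1 / 2 : ℝ)), hmm, one_mul]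
    _ ≤ m ^ (1 / 2 : ℝ) * (xNorm Ω A B w S f * q) := by gcongr
    _ = _ := by ring

end DegenerateDG

namespace DegenerateDG

/-! ### The Caccioppoli inequality -/

variable {n : ℕ} {Ω U S : Set (𝔼 n)} {A B : 𝔼 n → 𝔼 n →L[ℝ] 𝔼 n} {w : 𝔼 n → ℝ} {c C : ℝ}

/-- The quadratic form is nonnegative at `ξ + ζ` and at `ξ - ζ`. -/
lemma abs_two_mul_inner_le {T : 𝔼 n →L[ℝ] 𝔼 n} (hT : T.IsPositive) (ξ ζ : 𝔼 n) :
    |2 * inner ℝ ζ (T ξ)| ≤ inner ℝ ξ (T ξ) + inner ℝ ζ (T ζ) := by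
  have hsymm : inner ℝ ξ (T ζ) = inner ℝ ζ (T ξ) := by
    rw [← hT.inner_left_eq_inner_right, real_inner_comm]
  have h1 := hT.inner_nonneg_right (ξ + ζ)
  have h2 := hT.inner_nonneg_right (ξ - ζ)
  simp only [map_add, map_sub, inner_add_left, inner_add_right, inner_sub_left,
    inner_sub_right, hsymm] at h1 h2
  rw [abs_le]
  constructor <;> linarith

lemma DegenerateStructure.integrable_inner (h : DegenerateStructure Ω A B w c C)
    {H G : 𝔼 n → 𝔼 n} (hH : AEStronglyMeasurable H (volume.restrict Ω))
    (hG : AEStronglyMeasurable G (volume.restrict Ω)) (hHE : energy A Ω H < ∞)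
    (hGE : energy A Ω G < ∞) :
    Integrable (fun x => inner ℝ (H x) (A x (G x))) (volume.restrict Ω) := by
  have hm : ∀ {F F' : 𝔼 n → 𝔼 n}, AEStronglyMeasurable F (volume.restrict Ω) →
      AEStronglyMeasurable F' (volume.restrict Ω) →
      AEStronglyMeasurable (fun x => inner ℝ (F x) (A x (F' x))) (volume.restrict Ω) :=
    fun hF hF' => hF.inner
      (isBoundedBilinearMap_apply.continuous.comp_aestronglyMeasurable
        (h.aemeasurable_matrix.prodMk hF'))
  have hi : ∀ {F : 𝔼 n → 𝔼 n}, AEStronglyMeasurable F (volume.restrict Ω) → energy A Ω F < ∞ →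
      Integrable (fun x => inner ℝ (F x) (A x (F x))) (volume.restrict Ω) := fun hF hFE => by
    refine (lintegral_ofReal_ne_top_iff_integrable (hm hF hF) ?_).1 hFE.ne
    filter_upwards [h.matrix_nonneg] with x hx
    exact hx.inner_nonneg_right _
  refine ((hi hG hGE).add (hi hH hHE)).mono' (hm hH hG) ?_
  filter_upwards [h.matrix_nonneg] with x hx
  have h1 := abs_two_mul_inner_le hx (G x) (H x)
  rw [abs_mul, abs_two] at h1
  rw [Real.norm_eq_abs]
  have := abs_nonneg (inner ℝ (H x) (A x (G x)))
  simp only [Pi.add_apply]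
  linarith

lemma integral_norm_sq_eq {X F : Type*} [MeasurableSpace X] [NormedAddCommGroup F]
    {μ : Measure X} {f : X → F} (hf : AEStronglyMeasurable f μ) :
    ∫ x, ‖f x‖ ^ 2 ∂μ = (eLpNorm f 2 μ).toReal ^ 2 := by
  rw [← ENNReal.toReal_pow, eLpNorm_two_sq, integral_eq_lintegral_of_nonneg_ae
    (Eventually.of_forall fun x => sq_nonneg _) (hf.norm.pow 2)]

/-- The constant in the Caccioppoli inequality. -/
noncomputable def caccioppoliConst (c C : ℝ) : ℝ := 8 * C * (2 / c + 1) + 8 * C * (C + 1) + 2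

/-- The Caccioppoli inequality for the truncation `(u - l)₊` of a weak subsolution. -/
lemma IsWeakSubsolution.caccioppoli (h : DegenerateStructure Ω A B w c C) (hc : 0 < c)
    (hC : 0 < C) (hS : S ⊆ Ω) (hSo : IsOpen S) (hw : wMeasure Ω w S < ∞)
    {f u : 𝔼 n → ℝ} (hf : IsAdmissible Ω A B w S f) {G : 𝔼 n → 𝔼 n} (hu : MemW A Ω u G)
    (hsub : ∀ (g : 𝔼 n → ℝ) (H : 𝔼 n → 𝔼 n), IsTestFunction Ω A f g H →
      -(∫ x in Ω, inner ℝ (H x) (A x (G x))) ≥ ∫ x in Ω, f x * g x)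
    {l : ℝ} (hl : 0 ≤ l) (hlu : ∀ᵐ x ∂volume.restrict Ω, u x ≠ l)
    {ψ : 𝔼 n → ℝ} (hψ : IsLipC S ψ) (hψ0 : ∀ x, 0 ≤ ψ x) (hψ1 : ∀ x, ψ x ≤ 1) :
    eLpNorm (fun x => B x ((ψ x * step l (u x)) • G x + max (u x - l) 0 • gradient ψ x)) 2
        (volume.restrict S) ^ 2 ≤
      ENNReal.ofReal (caccioppoliConst c C) *
        (eLpNorm (fun x => max (u x - l) 0 • B x (gradient ψ x)) 2 (volume.restrict S) ^ 2 +
          xNorm Ω A B w S f ^ 2 * wMeasure Ω w {x | x ∈ S ∧ ψ x ≠ 0 ∧ l < u x}) := by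
  have hle : volume.restrict S ≤ volume.restrict Ω := Measure.restrict_mono hS le_rfl
  have hSm := hSo.measurableSet
  set p : 𝔼 n → ℝ := fun x => max (u x - l) 0 with hp
  have hη : IsLipC S fun x => ψ x * ψ x := hψ.mul_locallyLipschitzOn h.isOpen hS
    ((locallyLipschitzOn_univ.2 hψ.locallyLipschitz).mono (Set.subset_univ _))
  set H : 𝔼 n → 𝔼 n := fun x =>
    (ψ x * ψ x * step l (u x)) • G x + p x • gradient (fun x => ψ x * ψ x) x with hH
  set V : 𝔼 n → 𝔼 n := fun x => (ψ x * step l (u x)) • G x + p x • gradient ψ x with hV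
  -- The test function `ψ² (u - l)₊`, with gradient `H`. Below, `a` and `b` are the two parts of `B
  -- V` coming from `G` and from `∇ψ`.
  set g : 𝔼 n → ℝ := fun x => ψ x * ψ x * p x with hg
  have hgΩ : MemWZero A Ω g H :=
    hu.memWZero_cutoff_mul_posPart h hc hC hl hlu le_rfl (hη.mono hS)
  have hgS : MemWZero A S g H := hu.memWZero_cutoff_mul_posPart h hc hC hl hlu hS hη
  have hvS : MemWZero A S (fun x => ψ x * p x) V :=
    hu.memWZero_cutoff_mul_posPart h hc hC hl hlu hS hψ
  set a : 𝔼 n → 𝔼 n := fun x => (ψ x * step l (u x)) • B x (G x) with ha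
  set b : 𝔼 n → 𝔼 n := fun x => p x • B x (gradient ψ x) with hb
  have hGm : AEStronglyMeasurable G (volume.restrict Ω) := by
    obtain ⟨_, _, _, h1, _⟩ := hu; exact h1
  have hGE : energy A Ω G < ∞ := by
    obtain ⟨_, _, _, _, h1, _⟩ := hu; exact h1
  have hu2 : MemLp u 2 (volume.restrict Ω) := by
    obtain ⟨_, _, h1, _⟩ := hu; exact h1
  have hum : AEStronglyMeasurable u (volume.restrict S) := hu2.1.mono_measure hle
  have hψm : AEStronglyMeasurable ψ (volume.restrict S) :=
    hψ.locallyLipschitz.continuous.aestronglyMeasurable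
  have ham : AEStronglyMeasurable a (volume.restrict S) :=
    (hψm.mul ((measurable_step l).comp_aemeasurable hum.aemeasurable).aestronglyMeasurable).smul
      (h.aestronglyMeasurable_apply hS (hGm.mono_measure hle))
  have hbm : AEStronglyMeasurable b (volume.restrict S) :=
    ((hum.aemeasurable.sub_const l).max aemeasurable_const).aestronglyMeasurable.smul
      (h.aestronglyMeasurable_apply hS (measurable_gradient ψ).aestronglyMeasurable)
  have hVeq : (fun x => B x (V x)) = a + b := by
    funext x
    simp [hV, ha, hb]
  have hψs : ∀ x, ‖ψ x * step l (u x)‖ ≤ 1 := fun x => by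
    rw [norm_mul, Real.norm_of_nonneg (hψ0 x)]
    rcases step_eq_or l (u x) with h1 | h1 <;> simp [h1, hψ1 x]
  have ha2 : MemLp a 2 (volume.restrict S) := by
    refine ⟨ham, lt_of_le_of_lt (eLpNorm_mono_ae (g := fun x => B x (G x))
      (Eventually.of_forall fun x => ?_)) ((eLpNorm_mono_measure _ hle).trans_lt
        (h.eLpNorm_lt_top hC le_rfl hGE))⟩
    rw [ha, norm_smul]
    exact mul_le_of_le_one_left (norm_nonneg _) (hψs x)
  have hVfin : eLpNorm (fun x => B x (V x)) 2 (volume.restrict S) < ∞ := by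
    obtain ⟨_, _, _, _, h1, _⟩ := hvS
    exact h.eLpNorm_lt_top hC hS h1
  have hb2 : MemLp b 2 (volume.restrict S) := by
    have h1 : MemLp (fun x => B x (V x)) 2 (volume.restrict S) :=
      ⟨by rw [hVeq]; exact ham.add hbm, hVfin⟩
    have h2 : b = (fun x => B x (V x)) - a := by rw [hVeq]; simp
    rw [h2]
    exact h1.sub ha2
  set α := eLpNorm a 2 (volume.restrict S) with hα
  set β := eLpNorm b 2 (volume.restrict S) with hβ
  set σ := wMeasure Ω w {x | x ∈ S ∧ ψ x ≠ 0 ∧ l < u x} with hσ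
  set X := xNorm Ω A B w S f with hX
  have hσtop : σ ≠ ∞ := ((measure_mono fun x hx => hx.1).trans_lt hw).ne
  have hXtop : X ≠ ∞ := hf.2.ne
  have hαtop : α ≠ ∞ := ha2.2.ne
  have hβtop : β ≠ ∞ := hb2.2.ne
  have hdψ := hψ.ae_differentiableAt
  have hBH : eLpNorm (fun x => B x (H x)) 2 (volume.restrict S) ≤ α + 2 * β := by
    have heq : (fun x => B x (H x)) =ᵐ[volume.restrict S]
        ((fun x => ψ x • a x) + fun x => (2 * ψ x) • b x) := by
      filter_upwards [ae_restrict_of_ae hdψ] with x hx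
      simp only [hH, ha, hb, Pi.add_apply]
      rw [gradient_mul hx hx]
      simp only [map_add, map_smul]
      module
    rw [eLpNorm_congr_ae heq]
    refine (eLpNorm_add_le (hψm.smul ham) ((hψm.const_mul 2).smul hbm) one_le_two).trans
      (add_le_add ?_ ?_)
    · refine eLpNorm_mono_ae (g := a) (Eventually.of_forall fun x => ?_)
      rw [Pi.smul_apply', norm_smul, Real.norm_of_nonneg (hψ0 x)]
      exact mul_le_of_le_one_left (norm_nonneg _) (hψ1 x)
    · refine (eLpNorm_le_mul_eLpNorm_of_ae_le_mul (c := 2) (g := b)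
        (Eventually.of_forall fun x => ?_) 2).trans (by norm_num; rfl)
      rw [Pi.smul_apply', norm_smul, norm_mul, Real.norm_of_nonneg (hψ0 x), Real.norm_of_nonneg zero_le_two]
      have := hψ1 x
      gcongr
      linarith
  have hzero : ∀ x, x ∉ S → ψ x = 0 := fun x hx => hψ.eq_zero hx
  -- Admissibility concerns `S` only; since `ψ` vanishes off `S`, all integrals over `Ω` reduce to
  -- `S`.
  have hfg : ∀ x ∈ Ω \ S, f x * g x = 0 := fun x hx => by simp [hg, hzero x hx.2]
  have hint : IntegrableOn (fun x => f x * g x) Ω := by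
    refine IntegrableOn.of_forall_sdiff_eq_zero (s := S) ?_ h.isOpen.measurableSet hfg
    have := hf.1 g H hgS
    simpa only [mul_comm] using this
  have hpos : ∀ x, 0 ≤ g x := fun x =>
    mul_nonneg (mul_self_nonneg _) (le_max_right _ _)
  have hmain := hsub g H ⟨hgΩ, Eventually.of_forall hpos, hint⟩
  have hfgS : ∫ x in Ω, f x * g x = ∫ x in S, g x * f x := by
    rw [setIntegral_eq_of_subset_of_forall_sdiff_eq_zero h.isOpen.measurableSet hS hfg]
    simp only [mul_comm]
  -- A pointwise lower bound of `⟨H, A G⟩`.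
  set F : 𝔼 n → ℝ := fun x => (2 * C)⁻¹ * ‖a x‖ ^ 2 - 2 / c * ‖b x‖ ^ 2 with hF
  have hFS : Integrable F (volume.restrict S) :=
    (ha2.norm.integrable_sq.const_mul _).sub (hb2.norm.integrable_sq.const_mul _)
  have hF0 : ∀ x ∈ Ω \ S, F x = 0 := fun x hx => by
    simp [hF, ha, hb, hzero x hx.2, hψ.gradient_eq_zero hx.2]
  have hFΩ : IntegrableOn F Ω :=
    IntegrableOn.of_forall_sdiff_eq_zero hFS h.isOpen.measurableSet hF0
  have hHG : Integrable (fun x => inner ℝ (H x) (A x (G x))) (volume.restrict Ω) := by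
    obtain ⟨_, _, _, hHm, hHE, _⟩ := hgΩ
    exact h.integrable_inner hHm hGm hHE hGE
  have hFle : ∫ x in Ω, F x ≤ ∫ x in Ω, inner ℝ (H x) (A x (G x)) := by
    refine integral_mono_ae hFΩ hHG ?_
    filter_upwards [h.matrix_nonneg, h.comparable, ae_restrict_of_ae hdψ] with x hA hcomp hd
    simp only [hF, ha, hb, hH]
    rw [gradient_mul hd hd]
    rcases lt_or_ge l (u x) with hx | hx
    · have hs : step l (u x) = 1 := by simp [step, hx]
      -- Doubling the gradient of the cutoff balances the cross term: `|2ψp ∇ψ·AG| ≤ ½ ψ² G·AG + 2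
      -- p² ∇ψ·A∇ψ`.
      have h1 := (abs_le.1 (abs_two_mul_inner_le hA (ψ x • G x) ((2 * p x) • gradient ψ x))).1
      have h2 := (hcomp (ψ x • G x)).2
      have h3 := (hcomp (p x • gradient ψ x)).1
      simp only [map_smul, inner_smul_left, inner_smul_right, conj_trivial, norm_smul,
        inner_add_left, mul_pow, hs, mul_one] at h1 h2 h3 ⊢
      set GG := inner ℝ (G x) (A x (G x))
      set ZG := inner ℝ (gradient ψ x) (A x (G x))
      set ZZ := inner ℝ (gradient ψ x) (A x (gradient ψ x))
      have h4 : (2 * C)⁻¹ * (‖ψ x‖ ^ 2 * ‖B x (G x)‖ ^ 2) ≤ (ψ x * (ψ x * GG)) / 2 := by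
        rw [inv_mul_le_iff₀ (by positivity)]
        linarith
      have h5 : p x * (p x * ZZ) * 2 ≤ 2 / c * (‖p x‖ ^ 2 * ‖B x (gradient ψ x)‖ ^ 2) := by
        rw [div_mul_eq_mul_div, le_div_iff₀ hc]
        linarith
      linarith
    · have hs : step l (u x) = 0 := by simp [step, hx]
      have hp0 : p x = 0 := max_eq_right (by linarith)
      simp [hs, hp0]
  have hFeq : ∫ x in Ω, F x = (2 * C)⁻¹ * α.toReal ^ 2 - 2 / c * β.toReal ^ 2 := by
    rw [setIntegral_eq_of_subset_of_forall_sdiff_eq_zero h.isOpen.measurableSet hS hF0,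
      integral_sub (ha2.norm.integrable_sq.const_mul _) (hb2.norm.integrable_sq.const_mul _),
      integral_const_mul, integral_const_mul, integral_norm_sq_eq ham, integral_norm_sq_eq hbm]
  have hadm : |∫ x in S, g x * f x| ≤
      X.toReal * σ.toReal ^ (1 / 2 : ℝ) * (α.toReal + 2 * β.toReal) := by
    have h1 := ofReal_abs_integral_le_xNorm h hC hS hSm hw hf.2 hgS
    have h2 : wMeasure Ω w {y | y ∈ S ∧ g y ≠ 0} ≤ σ := by
      refine measure_mono fun y hy => ⟨hy.1, fun h0 => hy.2 (by simp [hg, h0]), ?_⟩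
      by_contra h0
      exact hy.2 (by
        have : p y = 0 := max_eq_right (by linarith)
        simp [hg, this])
    have h3 : ENNReal.ofReal |∫ x in S, g x * f x| ≤ X * σ ^ (1 / 2 : ℝ) * (α + 2 * β) := by
      refine h1.trans ?_
      gcongr
    have h4 := (ENNReal.ofReal_le_iff_le_toReal (by finiteness)).1 h3
    rwa [ENNReal.toReal_mul, ENNReal.toReal_mul, ENNReal.toReal_add hαtop (by finiteness),
      ENNReal.toReal_mul, ← ENNReal.toReal_rpow] at h4
  have hσsq : (σ.toReal ^ (1 / 2 : ℝ)) ^ 2 = σ.toReal := by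
    rw [← Real.rpow_mul_natCast ENNReal.toReal_nonneg]; norm_num
  have hreal : (2 * C)⁻¹ * α.toReal ^ 2 - 2 / c * β.toReal ^ 2 ≤
      X.toReal * σ.toReal ^ (1 / 2 : ℝ) * (α.toReal + 2 * β.toReal) := by
    rw [← hFeq]
    rw [hfgS] at hmain
    linarith [neg_abs_le (∫ x in S, g x * f x)]
  have hαβ : α.toReal ^ 2 * 2 + β.toReal ^ 2 * 2 ≤
      caccioppoliConst c C * (β.toReal ^ 2 + X.toReal ^ 2 * σ.toReal) := by
    set t := X.toReal * σ.toReal ^ (1 / 2 : ℝ) with ht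
    have ht2 : X.toReal ^ 2 * σ.toReal = t ^ 2 := by rw [ht, mul_pow, hσsq]
    rw [ht2]
    -- The weight `(4C)⁻¹` is half of the coefficient of `α²` in `hreal`, so this term is absorbed
    -- on the left.
    have h1 : t * α.toReal ≤ (4 * C)⁻¹ * α.toReal ^ 2 + C * t ^ 2 := by
      have : (4 * C)⁻¹ * α.toReal ^ 2 + C * t ^ 2 - t * α.toReal =
          (4 * C)⁻¹ * (α.toReal - 2 * C * t) ^ 2 := by field_simp; ring
      have h0 : 0 ≤ (4 * C)⁻¹ * (α.toReal - 2 * C * t) ^ 2 := by positivity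
      linarith
    have h2 : 2 * t * β.toReal ≤ t ^ 2 + β.toReal ^ 2 := by
      nlinarith [sq_nonneg (t - β.toReal)]
    have h3 : (2 * C)⁻¹ = 2 * (4 * C)⁻¹ := by field_simp; ring
    have h4 : (4 * C)⁻¹ * α.toReal ^ 2 ≤ (2 / c + 1) * β.toReal ^ 2 + (C + 1) * t ^ 2 := by
      rw [h3] at hreal
      linarith
    rw [inv_mul_le_iff₀ (by positivity)] at h4
    unfold caccioppoliConst
    have h5 : 0 ≤ 8 * C * (C + 1) * β.toReal ^ 2 := by positivity
    have h6 : 0 ≤ (8 * C * (2 / c + 1) + 2) * t ^ 2 := by positivity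
    linarith
  rw [hVeq]
  have hfin : eLpNorm (a + b) 2 (volume.restrict S) ≠ ∞ := (ha2.add hb2).2.ne
  have hK : 0 ≤ caccioppoliConst c C := by unfold caccioppoliConst; positivity
  rw [← ENNReal.toReal_le_toReal (by finiteness) (by finiteness), ENNReal.toReal_pow,
    ENNReal.toReal_mul, ENNReal.toReal_add (by finiteness) (by finiteness), ENNReal.toReal_pow,
    ENNReal.toReal_mul, ENNReal.toReal_pow, ENNReal.toReal_ofReal hK]
  refine le_trans ?_ hαβ
  have h1 : (eLpNorm (a + b) 2 (volume.restrict S)).toReal ≤ α.toReal + β.toReal := by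
    rw [← ENNReal.toReal_add hαtop hβtop]
    exact ENNReal.toReal_mono (by finiteness) (eLpNorm_add_le ham hbm one_le_two)
  calc _ ≤ (α.toReal + β.toReal) ^ 2 := by gcongr
    _ ≤ _ := by nlinarith [sq_nonneg (α.toReal - β.toReal)]

end DegenerateDG

namespace DegenerateDG

/-! ### Auxiliary facts on the weighted measure -/

variable {n : ℕ} {Ω U S : Set (𝔼 n)} {A B : 𝔼 n → 𝔼 n →L[ℝ] 𝔼 n} {w : 𝔼 n → ℝ} {c C : ℝ}
  {d : 𝔼 n → 𝔼 n → ℝ} {k : ℕ} {N : ℝ} {x : 𝔼 n} {r : ℝ}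

lemma mball_subset (Ω : Set (𝔼 n)) (d : 𝔼 n → 𝔼 n → ℝ) (x : 𝔼 n) (r : ℝ) :
    mball Ω d x r ⊆ Ω := fun _ hy => hy.1

lemma mball_mono {s t : ℝ} (hst : s ≤ t) : mball Ω d x s ⊆ mball Ω d x t :=
  fun _ hy => ⟨hy.1, hy.2.trans_le hst⟩

lemma wMeasure_absolutelyContinuous (Ω : Set (𝔼 n)) (w : 𝔼 n → ℝ) :
    wMeasure Ω w ≪ volume.restrict Ω :=
  withDensity_absolutelyContinuous _ _

lemma wMeasure_mball_ne_zero (h : DegenerateStructure Ω A B w c C) (hd : IsMetricOn Ω d)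
    (hx : x ∈ Ω) (hr : 0 < r) : wMeasure Ω w (mball Ω d x r) ≠ 0 := by
  intro h0
  have h1 := wMeasure_restrict_absolutelyContinuous h h0
  rw [Measure.restrict_apply (hd.isOpen_ball x hx r).measurableSet,
    Set.inter_eq_left.2 (mball_subset _ _ _ _)] at h1
  refine (hd.isOpen_ball x hx r).measure_ne_zero volume ⟨x, hx, ?_⟩ h1
  rwa [(hd.eq_zero_iff x hx x hx).2 rfl]

lemma setLIntegral_wMeasure (h : DegenerateStructure Ω A B w c C) (hS : S ⊆ Ω)
    (hSm : MeasurableSet S) {g : 𝔼 n → ℝ≥0∞} (hg : AEMeasurable g (volume.restrict Ω)) :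
    ∫⁻ y in S, g y ∂wMeasure Ω w = ∫⁻ y in S, ENNReal.ofReal (w y) * g y := by
  have hle : volume.restrict S ≤ volume.restrict Ω := Measure.restrict_mono hS le_rfl
  rw [wMeasure, restrict_withDensity hSm, Measure.restrict_restrict hSm,
    Set.inter_eq_left.2 hS]
  exact lintegral_withDensity_eq_lintegral_mul₀
    (h.aemeasurable_weight.mono_measure hle).ennreal_ofReal (hg.mono_measure hle)

/-- The cutoff bound contains `w^(1/2)`; its square turns Lebesgue measure into `w dx`. -/
lemma eLpNorm_smul_gradient_cutoff_sq_le (h : DegenerateStructure Ω A B w c C) {S' : Set (𝔼 n)}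
    (hS' : S' ⊆ Ω) (hSm' : MeasurableSet S') {ψ p : 𝔼 n → ℝ}
    (hψ : IsLipC S' ψ) (hp : AEMeasurable p (volume.restrict Ω)) (hS : S ⊆ Ω) {K : ℝ}
    (hK : ∀ᵐ y ∂volume.restrict Ω, ‖B y (gradient ψ y)‖ / (w y) ^ (1 / 2 : ℝ) ≤ K) :
    eLpNorm (fun y => p y • B y (gradient ψ y)) 2 (volume.restrict S) ^ 2 ≤
      ENNReal.ofReal (K ^ 2) * ∫⁻ y in S', ENNReal.ofReal (p y ^ 2) ∂wMeasure Ω w := by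
  have hle : volume.restrict S ≤ volume.restrict Ω := Measure.restrict_mono hS le_rfl
  rw [eLpNorm_two_sq, setLIntegral_wMeasure h hS' hSm' (hp.pow_const 2).ennreal_ofReal,
    ← lintegral_const_mul' _ _ ENNReal.ofReal_ne_top, ← lintegral_indicator hSm']
  refine (lintegral_mono' hle le_rfl).trans ((lintegral_mono_ae ?_).trans
    (lintegral_mono' Measure.restrict_le_self le_rfl))
  filter_upwards [h.weight_pos, hK] with y hw hy
  by_cases hyS : y ∈ S'
  · rw [Set.indicator_of_mem hyS, ← ENNReal.ofReal_mul hw.le, ← ENNReal.ofReal_mul (sq_nonneg _)]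
    refine ENNReal.ofReal_le_ofReal ?_
    rw [div_le_iff₀ (by positivity)] at hy
    have h1 : ((w y) ^ (1 / 2 : ℝ)) ^ 2 = w y := by
      rw [← Real.rpow_mul_natCast hw.le]; norm_num
    rw [norm_smul, mul_pow, Real.norm_eq_abs, sq_abs]
    calc p y ^ 2 * ‖B y (gradient ψ y)‖ ^ 2 ≤ p y ^ 2 * (K * (w y) ^ (1 / 2 : ℝ)) ^ 2 := by
          gcongr
      _ = _ := by rw [mul_pow, h1]; ring
  · simp [hψ.gradient_eq_zero hyS]

/-- Chebyshev's inequality for `(u - l₁)₊²`. -/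
lemma measure_level_set_le {S' : Set (𝔼 n)} (hSm' : MeasurableSet S') {u : 𝔼 n → ℝ}
    (hu : AEMeasurable u (volume.restrict Ω)) {l₁ l₂ : ℝ} (hl : l₁ < l₂) :
    ENNReal.ofReal ((l₂ - l₁) ^ 2) * wMeasure Ω w {y | y ∈ S' ∧ l₂ < u y} ≤
      ∫⁻ y in S', ENNReal.ofReal (max (u y - l₁) 0 ^ 2) ∂wMeasure Ω w := by
  have hm : AEMeasurable (fun y => ENNReal.ofReal (max (u y - l₁) 0 ^ 2))
      ((wMeasure Ω w).restrict S') :=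
    (((hu.mono_ac (wMeasure_absolutelyContinuous Ω w)).mono_measure
      Measure.restrict_le_self).sub_const l₁ |>.max aemeasurable_const |>.pow_const 2).ennreal_ofReal
  refine le_trans ?_ (mul_meas_ge_le_lintegral₀ hm (ENNReal.ofReal ((l₂ - l₁) ^ 2)))
  refine mul_le_mul_right ?_ _
  rw [Measure.restrict_apply' hSm']
  refine measure_mono fun y hy => ⟨ENNReal.ofReal_le_ofReal ?_, hy.1⟩
  refine pow_le_pow_left₀ (by linarith) (le_max_of_le_left ?_) 2
  linarith [hy.2]

/-- Integrates `v² ≤ a² M 1_T + (v² - a² M)₊`, valid when `v` vanishes off `T`. A small `w(T)` makes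
a large `M` affordable. -/
lemma MemWZero.lintegral_sq_le (h : DegenerateStructure Ω A B w c C) (hc : 0 < c)
    (hC : 0 < C) (hd : IsMetricOn Ω d) (hx : x ∈ Ω) (hr : 0 < r) (hN : 1 < N) {CS φr : ℝ}
    (hOS : OrliczSobolevOn Ω B w d (youngPhi k N) CS φr x r)
    (hw : wMeasure Ω w (mball Ω d x r) < ∞)
    {v : 𝔼 n → ℝ} {V : 𝔼 n → 𝔼 n} (hv : MemWZero A (mball Ω d x r) v V) {a M : ℝ}
    (hM : threshold k N ≤ M)
    (ha : ENNReal.ofReal (CS * φr) * (wMeasure Ω w (mball Ω d x r)) ^ (-(1 / 2) : ℝ) *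
      eLpNorm (fun y => B y (V y)) 2 (volume.restrict (mball Ω d x r)) < ENNReal.ofReal a)
    {T : Set (𝔼 n)} (hT : ∀ y ∈ mball Ω d x r, y ∉ T → v y = 0) :
    ∫⁻ y in mball Ω d x r, ENNReal.ofReal (v y ^ 2) ∂wMeasure Ω w ≤
      ENNReal.ofReal (a ^ 2 * M) * wMeasure Ω w T +
        ENNReal.ofReal (a ^ 2 / logBump k N M) * wMeasure Ω w (mball Ω d x r) := by
  have hW0 := wMeasure_mball_ne_zero h hd hx hr
  have hkey := hv.lintegral_sq_sub_le h hc hC hN hOS hW0 hM ha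
  have hSm := (hd.isOpen_ball x hx r).measurableSet
  set S := mball Ω d x r with hS
  have hM0 : 0 ≤ M := by linarith [two_le_threshold (k := k) hN]
  have hvm : AEMeasurable v ((wMeasure Ω w).restrict S) := by
    obtain ⟨_, _, h1, _⟩ := hv
    refine h1.1.aemeasurable.mono_ac ?_
    have := (wMeasure_absolutelyContinuous Ω w).restrict S
    rwa [Measure.restrict_restrict hSm, Set.inter_eq_left.2 (mball_subset _ _ _ _)] at this
  rw [normMeasure, lintegral_smul_measure, smul_eq_mul, mul_comm, ← div_eq_mul_inv,
    ENNReal.div_le_iff hW0 hw.ne] at hkey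
  calc ∫⁻ y in S, ENNReal.ofReal (v y ^ 2) ∂wMeasure Ω w
      ≤ ∫⁻ y in S, (T.indicator (fun _ => ENNReal.ofReal (a ^ 2 * M)) y +
          ENNReal.ofReal (v y ^ 2 - a ^ 2 * M)) ∂wMeasure Ω w := by
        refine setLIntegral_mono' hSm fun y hy => ?_
        by_cases hyT : y ∈ T
        · rw [Set.indicator_of_mem hyT]
          refine le_trans (le_of_eq ?_) ENNReal.ofReal_add_le
          ring_nf
        · simp [hT y hy hyT]
    _ = ∫⁻ y in S, T.indicator (fun _ => ENNReal.ofReal (a ^ 2 * M)) y ∂wMeasure Ω w +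
          ∫⁻ y in S, ENNReal.ofReal (v y ^ 2 - a ^ 2 * M) ∂wMeasure Ω w :=
        lintegral_add_right' _ ((hvm.pow_const 2).sub_const _).ennreal_ofReal
    _ ≤ _ := by
        refine add_le_add ?_ hkey
        refine (lintegral_indicator_const_le _ _).trans ?_
        gcongr
        exact Measure.restrict_le_self

/-! ### The adapted radii -/

/-- The constant `c` in the definition of the adapted radii. -/
noncomputable def radiiConst (k : ℕ) (N : ℝ) : ℝ := (2 * ∑' j : ℕ, (kappa k N (j + 1))⁻¹)⁻¹

/-- The differences telescope to `r/2`, so `c` times the sum of `1/κ(j)` is `1/2`. Hence `c` depends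
on `k` and `N` only, as the uniformity of the constants requires. -/
lemma IsAdaptedRadii.sub_eq {ρ : ℕ → ℝ} (hN : 1 < N) (hr : 0 < r) (h : IsAdaptedRadii k N r ρ) :
    0 < radiiConst k N ∧
      ∀ j : ℕ, 1 ≤ j → ρ j - ρ (j + 1) = radiiConst k N * r / kappa k N j := by
  obtain ⟨h1, h2, c, hc, h3⟩ := h
  have hκ : ∀ j : ℕ, 0 < kappa k N (j + 1) := fun j =>
    one_pos.trans_le (one_le_kappa hN (by omega))
  have hsum : HasSum (fun j : ℕ => c * r * (kappa k N (j + 1))⁻¹) (r - r / 2) := by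
    have hpos : ∀ j : ℕ, 0 ≤ c * r * (kappa k N (j + 1))⁻¹ := fun j => by
      have := hκ j; positivity
    rw [hasSum_iff_tendsto_nat_of_nonneg hpos]
    have h4 : (fun m : ℕ => ∑ j ∈ Finset.range m, c * r * (kappa k N (j + 1))⁻¹) =
        fun m => r - ρ (m + 1) := by
      funext m
      have h5 : ∀ j : ℕ, c * r * (kappa k N (j + 1))⁻¹ = ρ (j + 1) - ρ (j + 1 + 1) := fun j => by
        rw [h3 (j + 1) (by omega), div_eq_mul_inv]
      simp_rw [h5]
      rw [Finset.sum_range_sub' (fun j => ρ (j + 1)), zero_add, h1]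
    rw [h4]
    exact tendsto_const_nhds.sub (h2.comp (tendsto_add_atTop_nat 1))
  have hts := (hsum.mul_left (c * r)⁻¹).tsum_eq
  simp_rw [inv_mul_cancel_left₀ (mul_pos hc hr).ne'] at hts
  have hcc : radiiConst k N = c := by
    rw [radiiConst, hts]
    field_simp
    ring
  rw [hcc]
  exact ⟨hc, h3⟩

lemma IsAdaptedRadii.antitone {ρ : ℕ → ℝ} (hN : 1 < N) (hr : 0 < r)
    (h : IsAdaptedRadii k N r ρ) : Antitone fun j => ρ (j + 1) := by
  obtain ⟨hc, h3⟩ := h.sub_eq hN hr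
  refine antitone_nat_of_succ_le fun j => ?_
  have h1 := h3 (j + 1) (by omega)
  have h2 : 0 < kappa k N (j + 1) := one_pos.trans_le (one_le_kappa hN (by omega))
  have h4 : 0 < radiiConst k N * r / kappa k N (j + 1) := by positivity
  linarith

lemma IsAdaptedRadii.half_lt {ρ : ℕ → ℝ} (hN : 1 < N) (hr : 0 < r)
    (h : IsAdaptedRadii k N r ρ) {j : ℕ} (hj : 1 ≤ j) : r / 2 < ρ j := by
  obtain ⟨hc, h3⟩ := h.sub_eq hN hr
  have h1 := (h.antitone hN hr).le_of_tendsto (h.2.1.comp (tendsto_add_atTop_nat 1)) j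
  have h2 : 0 < kappa k N j := one_pos.trans_le (one_le_kappa hN hj)
  have h4 : 0 < radiiConst k N * r / kappa k N j := by positivity
  have := h3 j hj
  linarith

lemma IsAdaptedRadii.le {ρ : ℕ → ℝ} (hN : 1 < N) (hr : 0 < r)
    (h : IsAdaptedRadii k N r ρ) {j : ℕ} (hj : 1 ≤ j) : ρ j ≤ r := by
  have := h.antitone hN hr (Nat.zero_le (j - 1))
  simp only [zero_add, Nat.sub_add_cancel hj, h.1] at this
  exact this

lemma IsAdaptedRadii.lt {ρ : ℕ → ℝ} (hN : 1 < N) (hr : 0 < r)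
    (h : IsAdaptedRadii k N r ρ) {j : ℕ} (hj : 2 ≤ j) : ρ j < r := by
  obtain ⟨hc, h3⟩ := h.sub_eq hN hr
  have h2 : 0 < kappa k N (j - 1) := one_pos.trans_le (one_le_kappa hN (by omega))
  have h4 : 0 < radiiConst k N * r / kappa k N (j - 1) := by positivity
  have h5 := h3 (j - 1) (by omega)
  have h6 := h.le hN hr (j := j - 1) (by omega)
  rw [Nat.sub_add_cancel (by omega)] at h5
  linarith

/-! ### The De Giorgi iteration -/

/-- The energy constant of one step of the iteration. -/
noncomputable def energyConst (k : ℕ) (N c C Ccut R : ℝ) : ℝ :=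
  caccioppoliConst c C * (Ccut ^ 2 + R ^ 2 / (4 * radiiConst k N ^ 2))

lemma energyConst_pos {Ccut R : ℝ} (hc : 0 < c) (hC : 0 < C) (hCcut : 0 < Ccut) :
    0 < energyConst k N c C Ccut R := by
  -- Positivity of `radiiConst`, known only when adapted radii exist, is not needed: the quotient is
  -- nonnegative in any case.
  unfold energyConst caccioppoliConst
  positivity

/-- One step of the De Giorgi iteration. -/
lemma IsWeakSubsolution.iteration_step (h : DegenerateStructure Ω A B w c C) (hc : 0 < c)
    (hC : 0 < C) (hd : IsMetricOn Ω d) (hx : x ∈ Ω) (hr : 0 < r) {R : ℝ} (hrR : r ≤ R)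
    (hN : 1 < N) {CS Ccut φr : ℝ} (hCS : 0 < CS) (hCcut : 0 < Ccut) (hφ : 0 < φr)
    (hOS : OrliczSobolevOn Ω B w d (youngPhi k N) CS φr x r)
    (hw : wMeasure Ω w (mball Ω d x r) < ∞)
    {f u : 𝔼 n → ℝ} (hf : IsAdmissible Ω A B w (mball Ω d x r) f)
    {G : 𝔼 n → 𝔼 n} (hu : MemW A Ω u G)
    (hsub : ∀ (g : 𝔼 n → ℝ) (H : 𝔼 n → 𝔼 n), IsTestFunction Ω A f g H →
      -(∫ x in Ω, inner ℝ (H x) (A x (G x))) ≥ ∫ x in Ω, f x * g x)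
    (hrad : 0 < radiiConst k N) {s s' κ L l₁ l₂ y M D : ℝ} (hs : s ≤ r) (hs' : s' ≤ r)
    (hκ : 0 < κ) (hL : 0 < L) (hXL : xNorm Ω A B w (mball Ω d x r) f ≤ ENNReal.ofReal L)
    (hl₁ : 0 ≤ l₁) (hl : l₂ - l₁ = L * (2 * radiiConst k N / κ))
    (hlu : ∀ᵐ x ∂volume.restrict Ω, u x ≠ l₂)
    {ψ : 𝔼 n → ℝ} (hψ : IsLipC (mball Ω d x s) ψ) (hψ1 : ∀ y ∈ mball Ω d x s', ψ y = 1)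
    (hψB : ∀ᵐ y ∂volume.restrict Ω, ‖B y (gradient ψ y)‖ / (w y) ^ (1 / 2 : ℝ) ≤ Ccut * κ / r)
    (hy : 0 < y) (hM : threshold k N ≤ M)
    (hD₁ : 4 * CS ^ 2 * energyConst k N c C Ccut R * Real.exp 3 ≤ D)
    (hD₂ : 1 / (4 * radiiConst k N ^ 2) ≤ D)
    (hDb : D * (φr / r) ^ 2 * κ ^ 2 ≤ logBump k N M)
    (hDy : D * M * logBump k N M * κ ^ 2 * y ≤ 1)
    (hY : ∫⁻ z in mball Ω d x s, ENNReal.ofReal (max (u z - l₁) 0 ^ 2) ∂wMeasure Ω w ≤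
      ENNReal.ofReal (L ^ 2 * y) * wMeasure Ω w (mball Ω d x r)) :
    ∫⁻ z in mball Ω d x s', ENNReal.ofReal (max (u z - l₂) 0 ^ 2) ∂wMeasure Ω w ≤
      ENNReal.ofReal (L ^ 2 * (Real.exp (-3) * y)) * wMeasure Ω w (mball Ω d x r) := by
  -- The given cutoffs need not take values in `[0, 1]`, as the Caccioppoli inequality demands.
  obtain ⟨η, hη, hη0, hη1, hηψ, hηg⟩ := hψ.exists_truncation
  set cc := radiiConst k N with hcc
  have hηB : ∀ᵐ y ∂volume.restrict Ω,
      ‖B y (gradient η y)‖ / (w y) ^ (1 / 2 : ℝ) ≤ Ccut * κ / r := by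
    filter_upwards [hψB] with z hz
    rcases hηg z with h0 | h0
    · rw [h0, map_zero, norm_zero, zero_div]; positivity
    · rwa [h0]
  have hl12 : l₁ < l₂ := by
    have : 0 < L * (2 * cc / κ) := by positivity
    linarith
  have hl₂ : 0 ≤ l₂ := by linarith
  have hSo := hd.isOpen_ball x hx r
  have hSo' := hd.isOpen_ball x hx s
  have hW0 := wMeasure_mball_ne_zero h hd hx hr
  have hSS : mball Ω d x s ⊆ mball Ω d x r := mball_mono hs
  have hηS : IsLipC (mball Ω d x r) η := hη.mono hSS
  have hcac := IsWeakSubsolution.caccioppoli h hc hC (mball_subset _ _ _ _) hSo hw hf hu hsub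
    hl₂ hlu hηS hη0 hη1
  have hv := hu.memWZero_cutoff_mul_posPart h hc hC hl₂ hlu (mball_subset _ _ _ _) hηS
  have hum : AEMeasurable u (volume.restrict Ω) := by
    obtain ⟨_, _, h1, _⟩ := hu; exact h1.1.aemeasurable
  set W := wMeasure Ω w (mball Ω d x r) with hW
  set V : 𝔼 n → 𝔼 n :=
    fun x => (η x * step l₂ (u x)) • G x + max (u x - l₂) 0 • gradient η x with hV
  set T : Set (𝔼 n) := {z | z ∈ mball Ω d x s ∧ l₂ < u z} with hT
  have hb : eLpNorm (fun z => max (u z - l₂) 0 • B z (gradient η z)) 2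
      (volume.restrict (mball Ω d x r)) ^ 2 ≤
      ENNReal.ofReal ((Ccut * κ / r) ^ 2 * (L ^ 2 * y)) * W := by
    refine (eLpNorm_smul_gradient_cutoff_sq_le h (mball_subset _ _ _ _) hSo'.measurableSet hη
      (hum.sub_const l₂ |>.max aemeasurable_const) (mball_subset _ _ _ _) hηB).trans ?_
    rw [ENNReal.ofReal_mul (by positivity), mul_assoc]
    gcongr
    refine (lintegral_mono fun z => ENNReal.ofReal_le_ofReal ?_).trans hY
    gcongr
  have hTm : wMeasure Ω w T ≤ ENNReal.ofReal (y * κ ^ 2 / (4 * cc ^ 2)) * W := by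
    have h1 := (measure_level_set_le (w := w) hSo'.measurableSet hum hl12).trans hY
    have h2 : 0 < (l₂ - l₁) ^ 2 := by
      have : 0 < l₂ - l₁ := by linarith
      positivity
    rw [mul_comm, ← ENNReal.le_div_iff_mul_le (Or.inl (ENNReal.ofReal_pos.2 h2).ne')
      (Or.inl ENNReal.ofReal_ne_top)] at h1
    refine h1.trans (le_of_eq ?_)
    rw [ENNReal.mul_div_right_comm, ← ENNReal.ofReal_div_of_pos h2, hl]
    congr 2
    field_simp
    ring
  have hσ : wMeasure Ω w {z | z ∈ mball Ω d x r ∧ η z ≠ 0 ∧ l₂ < u z} ≤ wMeasure Ω w T := by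
    refine measure_mono fun z hz => ⟨?_, hz.2.2⟩
    by_contra h0
    exact hz.2.1 (hη.eq_zero h0)
  have hK : 0 ≤ caccioppoliConst c C := by unfold caccioppoliConst; positivity
  have hP := energyConst_pos (k := k) (N := N) (R := R) hc hC hCcut
  set P := energyConst k N c C Ccut R with hPdef
  have hVsq : eLpNorm (fun z => B z (V z)) 2 (volume.restrict (mball Ω d x r)) ^ 2 ≤
      ENNReal.ofReal (P * L ^ 2 * y * κ ^ 2 / r ^ 2) * W := by
    refine hcac.trans ?_
    calc _ ≤ ENNReal.ofReal (caccioppoliConst c C) *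
          (ENNReal.ofReal ((Ccut * κ / r) ^ 2 * (L ^ 2 * y)) * W +
            ENNReal.ofReal L ^ 2 * (ENNReal.ofReal (y * κ ^ 2 / (4 * cc ^ 2)) * W)) := by
          gcongr
          exact hσ.trans hTm
      _ = ENNReal.ofReal (caccioppoliConst c C * ((Ccut * κ / r) ^ 2 * (L ^ 2 * y) +
            L ^ 2 * (y * κ ^ 2 / (4 * cc ^ 2)))) * W := by
          rw [ENNReal.ofReal_mul hK, ENNReal.ofReal_add (by positivity) (by positivity),
            ENNReal.ofReal_mul (p := L ^ 2) (by positivity), ENNReal.ofReal_pow hL.le]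
          ring
      _ ≤ _ := by
          gcongr
          -- The term from `φ` lacks the factor `1/r²`; it is supplied at the cost of `R²`, whence
          -- the dependence on `R`.
          have h1 : 1 ≤ R ^ 2 / r ^ 2 := by
            rw [one_le_div (by positivity)]; gcongr
          have h2 : L ^ 2 * (y * κ ^ 2 / (4 * cc ^ 2)) ≤
              L ^ 2 * (y * κ ^ 2 / (4 * cc ^ 2)) * (R ^ 2 / r ^ 2) :=
            le_mul_of_one_le_right (by positivity) h1
          calc _ ≤ caccioppoliConst c C * ((Ccut * κ / r) ^ 2 * (L ^ 2 * y) +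
                L ^ 2 * (y * κ ^ 2 / (4 * cc ^ 2)) * (R ^ 2 / r ^ 2)) := by gcongr
            _ = _ := by
              rw [hPdef, energyConst, ← hcc]
              field_simp
  -- The factor `2` makes the bound on the gradient term strict.
  set a : ℝ := Real.sqrt (2 * (CS ^ 2 * (φr / r) ^ 2 * P * L ^ 2 * y * κ ^ 2)) with ha
  have ha0 : 0 < CS ^ 2 * (φr / r) ^ 2 * P * L ^ 2 * y * κ ^ 2 := by positivity
  have hasq : a ^ 2 = 2 * (CS ^ 2 * (φr / r) ^ 2 * P * L ^ 2 * y * κ ^ 2) :=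
    Real.sq_sqrt (by positivity)
  have halt : ENNReal.ofReal (CS * φr) * W ^ (-(1 / 2) : ℝ) *
      eLpNorm (fun z => B z (V z)) 2 (volume.restrict (mball Ω d x r)) < ENNReal.ofReal a := by
    by_contra hcon
    have h1 := pow_le_pow_left' (not_lt.1 hcon) 2
    rw [← ENNReal.ofReal_pow (Real.sqrt_nonneg _), hasq, mul_pow, mul_pow,
      ← ENNReal.ofReal_pow (by positivity)] at h1
    have h2 : (W ^ (-(1 / 2) : ℝ)) ^ 2 = W⁻¹ := by
      rw [← ENNReal.rpow_natCast, ← ENNReal.rpow_mul]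
      norm_num [ENNReal.rpow_neg_one]
    have h3 := h1.trans (mul_le_mul_right hVsq _)
    rw [h2] at h3
    have h4 : ENNReal.ofReal ((CS * φr) ^ 2) * W⁻¹ *
        (ENNReal.ofReal (P * L ^ 2 * y * κ ^ 2 / r ^ 2) * W) =
        ENNReal.ofReal (CS ^ 2 * (φr / r) ^ 2 * P * L ^ 2 * y * κ ^ 2) := by
      calc _ = ENNReal.ofReal ((CS * φr) ^ 2) *
            ENNReal.ofReal (P * L ^ 2 * y * κ ^ 2 / r ^ 2) * (W⁻¹ * W) := by ring
        _ = _ := by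
          rw [ENNReal.inv_mul_cancel hW0 hw.ne, mul_one, ← ENNReal.ofReal_mul (by positivity)]
          congr 1
          field_simp
    rw [h4, ENNReal.ofReal_le_ofReal_iff ha0.le] at h3
    linarith
  have hfin := hv.lintegral_sq_le h hc hC hd hx hr hN hOS hw hM halt (T := T) fun z hz hzT => by
    by_cases hzs : z ∈ mball Ω d x s
    · have : max (u z - l₂) 0 = 0 := by
        refine max_eq_right ?_
        by_contra h0
        exact hzT ⟨hzs, by linarith⟩
      simp [this]
    · simp [hη.eq_zero hzs]
  have hbump := one_le_logBump hN hM
  set b := logBump k N M with hbdef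
  have hM0 : 0 < M := by linarith [two_le_threshold (k := k) hN]
  calc ∫⁻ z in mball Ω d x s', ENNReal.ofReal (max (u z - l₂) 0 ^ 2) ∂wMeasure Ω w
      ≤ ∫⁻ z in mball Ω d x s', ENNReal.ofReal ((η z * max (u z - l₂) 0) ^ 2) ∂wMeasure Ω w := by
        refine setLIntegral_mono' (hd.isOpen_ball x hx s').measurableSet fun z hz => ?_
        rw [hηψ z (hψ1 z hz), one_mul]
    _ ≤ ∫⁻ z in mball Ω d x r, ENNReal.ofReal ((η z * max (u z - l₂) 0) ^ 2) ∂wMeasure Ω w :=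
        lintegral_mono_set (mball_mono hs')
    _ ≤ ENNReal.ofReal (a ^ 2 * M) * (ENNReal.ofReal (y * κ ^ 2 / (4 * cc ^ 2)) * W) +
        ENNReal.ofReal (a ^ 2 / b) * W := hfin.trans (by gcongr)
    _ = ENNReal.ofReal (a ^ 2 * M * (y * κ ^ 2 / (4 * cc ^ 2)) + a ^ 2 / b) * W := by
        rw [ENNReal.ofReal_add (by positivity) (by positivity),
          ENNReal.ofReal_mul (p := a ^ 2 * M) (by positivity)]
        ring
    _ ≤ _ := by
        gcongr
        -- By `hDy` the contribution of the level set is no larger than the term `a² / b`.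
        have h1 : M * (y * κ ^ 2 / (4 * cc ^ 2)) ≤ 1 / b := by
          rw [le_div_iff₀ (by positivity)]
          calc M * (y * κ ^ 2 / (4 * cc ^ 2)) * b
              = 1 / (4 * cc ^ 2) * (M * b * κ ^ 2 * y) := by ring
            _ ≤ D * (M * b * κ ^ 2 * y) := by gcongr
            _ ≤ 1 := by linarith
        have h2 : a ^ 2 * M * (y * κ ^ 2 / (4 * cc ^ 2)) + a ^ 2 / b ≤ 2 * (a ^ 2 / b) := by
          have := mul_le_mul_of_nonneg_left h1 (sq_nonneg a)
          rw [mul_one_div] at this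
          linarith
        refine h2.trans ?_
        -- By `hDb` the bump beats `(φr/r)² κ²`, and the `e³` inside `D` produces the contraction
        -- factor.
        rw [hasq, mul_div_assoc', div_le_iff₀ (by positivity)]
        have h3 : Real.exp (-3) * Real.exp 3 = 1 := by rw [← Real.exp_add]; simp
        calc 2 * (2 * (CS ^ 2 * (φr / r) ^ 2 * P * L ^ 2 * y * κ ^ 2))
            = (4 * CS ^ 2 * P * (Real.exp (-3) * Real.exp 3)) * ((φr / r) ^ 2 * κ ^ 2) *
              (L ^ 2 * y) := by rw [h3]; ring
          _ = Real.exp (-3) * ((4 * CS ^ 2 * P * Real.exp 3) * ((φr / r) ^ 2 * κ ^ 2)) *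
              (L ^ 2 * y) := by ring
          _ ≤ Real.exp (-3) * (D * ((φr / r) ^ 2 * κ ^ 2)) * (L ^ 2 * y) := by gcongr
          _ = Real.exp (-3) * (D * (φr / r) ^ 2 * κ ^ 2) * (L ^ 2 * y) := by ring
          _ ≤ Real.exp (-3) * b * (L ^ 2 * y) := by gcongr
          _ = _ := by ring

end DegenerateDG

namespace DegenerateDG

/-! ### Local boundedness -/

variable {n : ℕ} {Ω U S : Set (𝔼 n)} {A B : 𝔼 n → 𝔼 n →L[ℝ] 𝔼 n} {w : 𝔼 n → ℝ} {c C : ℝ}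
  {d : 𝔼 n → 𝔼 n → ℝ} {k : ℕ} {N : ℝ} {x : 𝔼 n} {r : ℝ}

/-- Level sets are disjoint, and an s-finite measure charges only countably many of them. -/
lemma countable_setOf_level_not_null {X : Type*} [MeasurableSpace X] {μ : Measure X} [SFinite μ]
    {u : X → ℝ} (hu : AEMeasurable u μ) : {t : ℝ | ¬ ∀ᵐ x ∂μ, u x ≠ t}.Countable := by
  refine (Measure.countable_meas_level_set_pos₀ hu.nullMeasurable).mono fun t ht => ?_
  simp only [Set.mem_ofPred_eq, ae_iff, not_not] at ht
  exact pos_iff_ne_zero.2 ht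

/-- The lower bound required of the numerical constant of the iteration. -/
noncomputable def iterationConst (k : ℕ) (N c C CS Ccut R : ℝ) : ℝ :=
  4 * CS ^ 2 * energyConst k N c C Ccut R * Real.exp 3 + 1 / (4 * radiiConst k N ^ 2)

/-- A level `L` above the right-hand side of the local estimate, all of whose multiples used in the
iteration avoid the level sets of positive measure, is an upper bound of the subsolution. -/
lemma IsWeakSubsolution.ae_le_of_level (h : DegenerateStructure Ω A B w c C) (hc : 0 < c)
    (hC : 0 < C) (hd : IsMetricOn Ω d) (hx : x ∈ Ω) (hr : 0 < r) {R : ℝ} (hrR : r ≤ R)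
    (hN : 1 < N) {CS Ccut φr : ℝ} (hCS : 0 < CS) (hCcut : 0 < Ccut) (hφ : 0 < φr)
    (hOS : OrliczSobolevOn Ω B w d (youngPhi k N) CS φr x r)
    (hw : wMeasure Ω w (mball Ω d x r) < ∞)
    {f u : 𝔼 n → ℝ} (hf : IsAdmissible Ω A B w (mball Ω d x r) f)
    {G : 𝔼 n → 𝔼 n} (hu : MemW A Ω u G)
    (hsub : ∀ (g : 𝔼 n → ℝ) (H : 𝔼 n → 𝔼 n), IsTestFunction Ω A f g H →
      -(∫ x in Ω, inner ℝ (H x) (A x (G x))) ≥ ∫ x in Ω, f x * g x)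
    {ρ : ℕ → ℝ} {ψ : ℕ → 𝔼 n → ℝ} (hρ : IsAdaptedRadii k N r ρ)
    (hψ : ∀ j : ℕ, 1 ≤ j →
      IsLipC (mball Ω d x (ρ j)) (ψ j) ∧ (∀ y ∈ mball Ω d x (ρ (j + 1)), ψ j y = 1) ∧
      ∀ᵐ y ∂volume.restrict Ω,
        ‖B y (gradient (ψ j) y)‖ / (w y) ^ (1 / 2 : ℝ) ≤ Ccut * kappa k N j / r)
    {y M : ℕ → ℝ} (hyM : ∀ j, 1 ≤ j → 0 < y j ∧ threshold k N ≤ M j ∧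
      iterationConst k N c C CS Ccut R * (φr / r) ^ 2 * kappa k N j ^ 2 ≤ logBump k N (M j) ∧
      iterationConst k N c C CS Ccut R * M j * logBump k N (M j) * kappa k N j ^ 2 * y j ≤ 1)
    (hy : ∀ j, y (j + 1) = Real.exp (-3) * y j) {L : ℝ} (hL : 0 < L)
    (hXL : xNorm Ω A B w (mball Ω d x r) f ≤ ENNReal.ofReal L)
    (hinit : ∫⁻ z in mball Ω d x r, ENNReal.ofReal (max (u z) 0 ^ 2) ∂wMeasure Ω w ≤
      ENNReal.ofReal (L ^ 2 * y 1) * wMeasure Ω w (mball Ω d x r))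
    (hgen : ∀ j, 2 ≤ j → ∀ᵐ x ∂volume.restrict Ω, u x ≠ L * (2 * (1 - ρ j / r))) :
    ∀ᵐ z ∂volume.restrict (mball Ω d x (r / 2)), u z ≤ L := by
  obtain ⟨hrad, hρd⟩ := hρ.sub_eq hN hr
  have hP := energyConst_pos (k := k) (N := N) (R := R) hc hC hCcut
  set W := wMeasure Ω w (mball Ω d x r) with hW
  -- The level vanishes at the index `1`, since `ρ 1 = r`, and stays below `L`, since `ρ j > r/2`.
  have key : ∀ j : ℕ, ∫⁻ z in mball Ω d x (ρ (j + 1)),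
      ENNReal.ofReal (max (u z - L * (2 * (1 - ρ (j + 1) / r))) 0 ^ 2) ∂wMeasure Ω w ≤
      ENNReal.ofReal (L ^ 2 * y (j + 1)) * W := by
    intro j
    induction j with
    | zero =>
      have h1 : L * (2 * (1 - ρ 1 / r)) = 0 := by
        rw [hρ.1, div_self hr.ne']; ring
      simp only [zero_add, h1, sub_zero]
      rw [hρ.1]
      exact hinit
    | succ j ih =>
      have hj1 : 1 ≤ j + 1 := by omega
      obtain ⟨h1, h2, h3, h4⟩ := hyM (j + 1) hj1
      obtain ⟨h5, h6, h7⟩ := hψ (j + 1) hj1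
      have hκ : 0 < kappa k N (j + 1) := one_pos.trans_le (one_le_kappa hN hj1)
      rw [hy (j + 1)]
      refine IsWeakSubsolution.iteration_step h hc hC hd hx hr hrR hN hCS hCcut hφ hOS hw hf hu
        hsub hrad (hρ.le hN hr hj1) (hρ.le hN hr (by omega)) hκ hL hXL ?_ ?_ (hgen _ (by omega))
        h5 h6 h7 h1 h2 (D := iterationConst k N c C CS Ccut R) ?_ ?_ h3 h4 ih
      · have : ρ (j + 1) / r ≤ 1 := (div_le_one hr).2 (hρ.le hN hr hj1)
        have h8 : 0 ≤ 1 - ρ (j + 1) / r := by linarith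
        positivity
      · have h8 := hρd (j + 1) hj1
        have h9 : ρ (j + 1) / r - ρ (j + 1 + 1) / r = radiiConst k N / kappa k N (j + 1) := by
          rw [← sub_div, h8]
          field_simp
        rw [mul_div_assoc, ← h9]
        ring
      · exact le_add_of_nonneg_right (by positivity)
      · exact le_add_of_nonneg_left (by positivity)
  have hygeom : ∀ j, y (j + 1) = Real.exp (-3) ^ j * y 1 := fun j => by
    induction j with
    | zero => simp
    | succ j ih => rw [hy, ih]; ring
  have hylim : Tendsto (fun j => ENNReal.ofReal (L ^ 2 * y (j + 1)) * W) atTop (𝓝 0) := by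
    have h1 : Tendsto (fun j => L ^ 2 * y (j + 1)) atTop (𝓝 0) := by
      rw [funext fun j => congrArg (L ^ 2 * ·) (hygeom j)]
      have := (tendsto_pow_atTop_nhds_zero_of_lt_one (Real.exp_pos (-3)).le
        (by simp)).mul_const (y 1) |>.const_mul (L ^ 2)
      rwa [zero_mul, mul_zero] at this
    have h2 := ENNReal.Tendsto.mul_const (ENNReal.tendsto_ofReal h1) (b := W) (Or.inr hw.ne)
    simpa using h2
  have hzero : ∫⁻ z in mball Ω d x (r / 2), ENNReal.ofReal (max (u z - L) 0 ^ 2)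
      ∂wMeasure Ω w = 0 := by
    refine le_antisymm (ge_of_tendsto' hylim fun j => le_trans ?_ (key j)) zero_le
    have hj := hρ.half_lt hN hr (j := j + 1) (by omega)
    refine (lintegral_mono_set (mball_mono hj.le)).trans (lintegral_mono fun z => ?_)
    refine ENNReal.ofReal_le_ofReal (pow_le_pow_left₀ (le_max_right _ _) ?_ 2)
    refine max_le_max_right _ ?_
    have h1 : 1 / 2 ≤ ρ (j + 1) / r := by rw [le_div_iff₀ hr]; linarith
    nlinarith
  have hum : AEMeasurable u (volume.restrict Ω) := by
    obtain ⟨_, _, h1, _⟩ := hu; exact h1.1.aemeasurable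
  have hSm := (hd.isOpen_ball x hx (r / 2)).measurableSet
  rw [lintegral_eq_zero_iff' ((((hum.mono_ac (wMeasure_absolutelyContinuous Ω w)).mono_measure
      Measure.restrict_le_self).sub_const L |>.max aemeasurable_const).pow_const 2).ennreal_ofReal]
    at hzero
  have hac : volume.restrict (mball Ω d x (r / 2)) ≪
      (wMeasure Ω w).restrict (mball Ω d x (r / 2)) := by
    have := (wMeasure_restrict_absolutelyContinuous h).restrict (mball Ω d x (r / 2))
    rwa [Measure.restrict_restrict hSm, Set.inter_eq_left.2 (mball_subset _ _ _ _)] at this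
  filter_upwards [hac.ae_le hzero] with z hz
  simp only [Pi.zero_apply, ENNReal.ofReal_eq_zero] at hz
  by_contra hcon
  rw [max_eq_left (by linarith)] at hz
  have : 0 < (u z - L) ^ 2 := by
    have : 0 < u z - L := by linarith
    positivity
  linarith

/-- The local estimate for weak subsolutions on one ball. -/
lemma IsWeakSubsolution.eLpNorm_le (h : DegenerateStructure Ω A B w c C) (hc : 0 < c)
    (hC : 0 < C) (hd : IsMetricOn Ω d) (hx : x ∈ Ω) (hr : 0 < r) {R : ℝ} (hrR : r ≤ R)
    (hk : 1 ≤ k) (hN : 1 < N) {CS Ccut C₁ C₂ : ℝ} {φ : ℝ → ℝ} (hCS : 0 < CS) (hCcut : 0 < Ccut)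
    (hC₁ : 0 < C₁) (hφ : r ≤ φ r)
    (hiter : ∀ θ : ℝ, 1 ≤ θ → ∃ y M : ℕ → ℝ,
      (∀ j, 1 ≤ j → 0 < y j ∧ threshold k N ≤ M j ∧
        iterationConst k N c C CS Ccut R * θ ^ 2 * kappa k N j ^ 2 ≤ logBump k N (M j) ∧
        iterationConst k N c C CS Ccut R * M j * logBump k N (M j) * kappa k N j ^ 2 * y j ≤ 1) ∧
      (∀ j, y (j + 1) = Real.exp (-3) * y j) ∧
      1 ≤ (C₁ * (Real.exp^[k] (C₂ * θ ^ (2 / (N - 1)))) ^ (1 / 2 : ℝ)) ^ 2 * y 1)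
    (hOS : OrliczSobolevOn Ω B w d (youngPhi k N) CS (φ r) x r)
    (hcut : HasAdaptedCutoffs Ω B w d k N Ccut x r)
    (hw : wMeasure Ω w (mball Ω d x r) < ∞)
    {f u : 𝔼 n → ℝ} (hf : IsAdmissible Ω A B w (mball Ω d x r) f)
    (hu : IsWeakSubsolution Ω A f u) :
    eLpNorm (fun y => max (u y) 0) ∞ (volume.restrict (mball Ω d x (r / 2))) ≤
      ENNReal.ofReal (innerConst k N C₁ C₂ φ r) *
          ((wMeasure Ω w (mball Ω d x r))⁻¹ *
            ∫⁻ y in mball Ω d x r, ENNReal.ofReal (max (u y) 0 ^ 2)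
              ∂wMeasure Ω w) ^ (1 / 2 : ℝ) +
        xNorm Ω A B w (mball Ω d x r) f := by
  obtain ⟨G, hu, hsub⟩ := hu
  obtain ⟨ρ, ψ, hρ, hψ⟩ := hcut
  obtain ⟨y, M, hyM, hy, hA⟩ := hiter (φ r / r) ((one_le_div hr).2 hφ)
  change 1 ≤ innerConst k N C₁ C₂ φ r ^ 2 * y 1 at hA
  have hAc0 : 0 ≤ innerConst k N C₁ C₂ φ r := by
    rw [innerConst, ← Nat.sub_add_cancel hk, Function.iterate_succ_apply']
    positivity
  set Ac := innerConst k N C₁ C₂ φ r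
  have hW0 := wMeasure_mball_ne_zero h hd hx hr
  set W := wMeasure Ω w (mball Ω d x r) with hW
  set J := ∫⁻ y in mball Ω d x r, ENNReal.ofReal (max (u y) 0 ^ 2) ∂wMeasure Ω w with hJ
  have hum : AEMeasurable u (volume.restrict Ω) := by
    obtain ⟨_, _, h1, _⟩ := hu; exact h1.1.aemeasurable
  -- It suffices to bound by every `b` above the right-hand side, which leaves an interval for the
  -- choice of `L`; nothing is to be shown if that side is infinite.
  refine le_of_forall_gt_imp_ge_of_dense fun b hb => ?_
  obtain ⟨q₁, hq₁, hq₁b⟩ := ENNReal.lt_iff_exists_nnreal_btwn.1 hb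
  obtain ⟨q₂, hq₂, hq₂b⟩ := ENNReal.lt_iff_exists_nnreal_btwn.1 hq₁b
  -- All levels are multiples of `L`, so only countably many values of `L` are excluded. The index
  -- starts at `2`: the level of index `1` is `0` and is never used for a truncation.
  have hbad : (⋃ j : ℕ, (fun t => t / (2 * (1 - ρ (j + 2) / r))) ''
      {t : ℝ | ¬ ∀ᵐ x ∂volume.restrict Ω, u x ≠ t}).Countable :=
    Set.countable_iUnion fun j => (countable_setOf_level_not_null hum).image _
  obtain ⟨L, hLbad, hL₁, hL₂⟩ := (hbad.dense_compl ℝ).exists_between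
    (show (q₁ : ℝ) < q₂ by exact_mod_cast hq₂)
  have hL : 0 < L := q₁.2.trans_lt hL₁
  have hLq : ENNReal.ofReal Ac * (W⁻¹ * J) ^ (1 / 2 : ℝ) + xNorm Ω A B w (mball Ω d x r) f ≤
      ENNReal.ofReal L := by
    refine hq₁.le.trans ?_
    rw [← ENNReal.ofReal_coe_nnreal]
    exact ENNReal.ofReal_le_ofReal hL₁.le
  have hgen : ∀ j, 2 ≤ j → ∀ᵐ x ∂volume.restrict Ω, u x ≠ L * (2 * (1 - ρ j / r)) := by
    intro j hj
    by_contra hcon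
    refine hLbad (Set.mem_iUnion.2 ⟨j - 2, L * (2 * (1 - ρ j / r)), hcon, ?_⟩)
    have h1 : ρ j / r < 1 := (div_lt_one hr).2 (hρ.lt hN hr hj)
    have h2 : 0 < 2 * (1 - ρ j / r) := by linarith
    simp only [Nat.sub_add_cancel hj]
    exact mul_div_cancel_right₀ _ h2.ne'
  -- Since `L ≥ Ac (J/W)^(1/2)` and `Ac² y_1 ≥ 1`, the induction can start.
  have hinit : J ≤ ENNReal.ofReal (L ^ 2 * y 1) * W := by
    have hy1 := (hyM 1 le_rfl).1
    have h1 : ENNReal.ofReal (Ac ^ 2) * (W⁻¹ * J) ≤ ENNReal.ofReal (L ^ 2) := by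
      have h2 := pow_le_pow_left' (le_self_add.trans hLq) 2
      rw [mul_pow, ← ENNReal.ofReal_pow hAc0,
        ← ENNReal.ofReal_pow hL.le] at h2
      have h3 : ((W⁻¹ * J) ^ (1 / 2 : ℝ)) ^ 2 = W⁻¹ * J := by
        rw [← ENNReal.rpow_natCast, ← ENNReal.rpow_mul]; norm_num
      rwa [h3] at h2
    calc J = 1 * (W⁻¹ * J) * W := by
          rw [one_mul, mul_comm, ← mul_assoc, ENNReal.mul_inv_cancel hW0 hw.ne, one_mul]
      _ ≤ ENNReal.ofReal (Ac ^ 2 * y 1) * (W⁻¹ * J) * W := by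
          gcongr
          exact ENNReal.one_le_ofReal.2 hA
      _ = ENNReal.ofReal (Ac ^ 2) * (W⁻¹ * J) * ENNReal.ofReal (y 1) * W := by
          rw [ENNReal.ofReal_mul (sq_nonneg _)]; ring
      _ ≤ ENNReal.ofReal (L ^ 2) * ENNReal.ofReal (y 1) * W := by gcongr
      _ = _ := by rw [ENNReal.ofReal_mul (sq_nonneg _)]
  have hmain := IsWeakSubsolution.ae_le_of_level h hc hC hd hx hr hrR hN hCS hCcut
    (hr.trans_le hφ) hOS hw hf hu hsub hρ hψ hyM hy hL (le_add_self.trans hLq) hinit hgen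
  refine le_trans ?_ (le_trans (ENNReal.ofReal_le_ofReal hL₂.le)
    (by rw [ENNReal.ofReal_coe_nnreal]; exact hq₂b.le))
  rw [eLpNorm_exponent_top]
  refine eLpNormEssSup_le_of_ae_bound ?_
  filter_upwards [hmain] with z hz
  rw [Real.norm_of_nonneg (le_max_right _ _)]
  exact max_le hz hL.le

/-- Functions of `W_A^{1,2}(Ω)` are locally square integrable with respect to the weight. -/
lemma MemW.exists_lintegral_sq_lt_top (h : DegenerateStructure Ω A B w c C) (hc : 0 < c)
    (hC : 0 < C) (hd : IsMetricOn Ω d) (hx : x ∈ Ω) (hr : 0 < r) (hN : 1 < N) {CS Ccut φr : ℝ}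
    (hOS : OrliczSobolevOn Ω B w d (youngPhi k N) CS φr x r)
    (hcut : HasAdaptedCutoffs Ω B w d k N Ccut x r)
    (hw : wMeasure Ω w (mball Ω d x r) < ∞)
    {u : 𝔼 n → ℝ} {G : 𝔼 n → 𝔼 n} (hu : MemW A Ω u G) :
    ∃ s : ℝ, 0 < s ∧
      ∫⁻ y in mball Ω d x s, ENNReal.ofReal (max (u y) 0 ^ 2) ∂wMeasure Ω w < ∞ := by
  obtain ⟨ρ, ψ, hρ, hψ⟩ := hcut
  obtain ⟨hψ1, hψ2, -⟩ := hψ 1 le_rfl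
  rw [hρ.1] at hψ1
  have hW0 := wMeasure_mball_ne_zero h hd hx hr
  have hum : AEMeasurable u (volume.restrict Ω) := by
    obtain ⟨_, _, h1, _⟩ := hu; exact h1.1.aemeasurable
  -- Membership in `W_A^{1,2}` gives square integrability for `dx` only, and `w` may be unbounded.
  -- The Orlicz–Sobolev inequality is applied to `ψ₁ (u - l)₊`; a level `l` in `(0, 1)` is used
  -- because `{u = 0}` may have positive measure.
  obtain ⟨l, hlbad, hl0, -⟩ := ((countable_setOf_level_not_null hum).dense_compl ℝ).exists_between
    (zero_lt_one' ℝ)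
  have hlu : ∀ᵐ x ∂volume.restrict Ω, u x ≠ l := by
    by_contra hcon; exact hlbad hcon
  have hv := hu.memWZero_cutoff_mul_posPart h hc hC hl0.le hlu (mball_subset _ _ _ _) hψ1
  have hs2 := hρ.half_lt hN hr (j := 2) (by norm_num)
  have hle2 := hρ.le hN hr (j := 2) (by norm_num)
  have hVfin : eLpNorm (fun y => B y ((ψ 1 y * step l (u y)) • G y +
      max (u y - l) 0 • gradient (ψ 1) y)) 2 (volume.restrict (mball Ω d x r)) < ∞ := by
    obtain ⟨_, _, _, _, h1, _⟩ := hv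
    exact h.eLpNorm_lt_top hC (mball_subset _ _ _ _) h1
  have hqtop : ENNReal.ofReal (CS * φr) * (wMeasure Ω w (mball Ω d x r)) ^ (-(1 / 2) : ℝ) *
      eLpNorm (fun y => B y ((ψ 1 y * step l (u y)) • G y +
      max (u y - l) 0 • gradient (ψ 1) y)) 2 (volume.restrict (mball Ω d x r)) < ∞ :=
    ENNReal.mul_lt_top (ENNReal.mul_lt_top ENNReal.ofReal_lt_top
      (lt_top_iff_ne_top.2 (by simp [ENNReal.rpow_eq_top_iff, hW0]))) hVfin
  obtain ⟨a, ha, -⟩ := ENNReal.lt_iff_exists_nnreal_btwn.1 hqtop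
  rw [← ENNReal.ofReal_coe_nnreal] at ha
  have hfin := hv.lintegral_sq_le h hc hC hd hx hr hN hOS hw le_rfl ha
    (T := mball Ω d x r) fun y hy hy' => absurd hy hy'
  refine ⟨ρ 2, by linarith, ?_⟩
  set W := wMeasure Ω w (mball Ω d x r)
  calc ∫⁻ y in mball Ω d x (ρ 2), ENNReal.ofReal (max (u y) 0 ^ 2) ∂wMeasure Ω w
      ≤ ∫⁻ y in mball Ω d x (ρ 2), (ENNReal.ofReal (2 * l ^ 2) +
          ENNReal.ofReal 2 * ENNReal.ofReal ((ψ 1 y * max (u y - l) 0) ^ 2)) ∂wMeasure Ω w := by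
        refine setLIntegral_mono' (hd.isOpen_ball x hx _).measurableSet fun y hy => ?_
        rw [hψ2 y hy, one_mul, ← ENNReal.ofReal_mul zero_le_two,
          ← ENNReal.ofReal_add (by positivity) (by positivity)]
        refine ENNReal.ofReal_le_ofReal ?_
        have h1 : max (u y) 0 ≤ l + max (u y - l) 0 :=
          max_le (by linarith [le_max_left (u y - l) 0]) (by positivity)
        calc max (u y) 0 ^ 2 ≤ (l + max (u y - l) 0) ^ 2 := by gcongr
          _ ≤ _ := by nlinarith [sq_nonneg (l - max (u y - l) 0)]
    _ ≤ ∫⁻ y in mball Ω d x r, (ENNReal.ofReal (2 * l ^ 2) +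
          ENNReal.ofReal 2 * ENNReal.ofReal ((ψ 1 y * max (u y - l) 0) ^ 2)) ∂wMeasure Ω w :=
        lintegral_mono_set (mball_mono hle2)
    _ < ∞ := by
        rw [lintegral_add_left measurable_const, lintegral_const_mul' _ _ ENNReal.ofReal_ne_top,
          lintegral_const, Measure.restrict_apply_univ]
        refine ENNReal.add_lt_top.2 ⟨ENNReal.mul_lt_top ENNReal.ofReal_lt_top hw,
          ENNReal.mul_lt_top ENNReal.ofReal_lt_top (hfin.trans_lt ?_)⟩
        exact ENNReal.add_lt_top.2 ⟨ENNReal.mul_lt_top ENNReal.ofReal_lt_top hw,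
          ENNReal.mul_lt_top ENNReal.ofReal_lt_top hw⟩

/-! ### From subsolutions to solutions: change of sign and compactness. -/

lemma MemW.neg {u : 𝔼 n → ℝ} {G : 𝔼 n → 𝔼 n} (hu : MemW A U u G) :
    MemW A U (fun x => -u x) (fun x => -G x) := by
  obtain ⟨f, hf, hu2, hGm, hGE, hL2, hEn⟩ := hu
  have hE : ∀ F : 𝔼 n → 𝔼 n, energy A U (fun x => -F x) = energy A U F := fun F => by
    simp [energy]
  have hgrad : ∀ m x, gradient (fun y => -f m y) x = -gradient (f m) x := fun m x => by
    simp [gradient, fderiv_fun_neg]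
  refine ⟨fun m x => -f m x, fun m => (hf m).neg, hu2.neg, hGm.neg, (hE G).trans_lt hGE, ?_, ?_⟩
  · refine hL2.congr fun m => ?_
    rw [← eLpNorm_neg]
    congr 1
    funext x
    simp only [Pi.neg_apply]
    ring
  · refine hEn.congr fun m => ?_
    rw [← hE]
    congr 1
    funext x
    rw [hgrad, neg_sub, sub_neg_eq_add, neg_add_eq_sub]

lemma IsWeakSolution.isWeakSubsolution {f u : 𝔼 n → ℝ} (hu : IsWeakSolution Ω A f u) :
    IsWeakSubsolution Ω A f u := by
  obtain ⟨G, hu, hs⟩ := hu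
  exact ⟨G, hu, fun g H hg => (hs g H hg).ge⟩

lemma IsWeakSolution.neg {f u : 𝔼 n → ℝ} (hu : IsWeakSolution Ω A f u) :
    IsWeakSolution Ω A (fun x => -f x) (fun x => -u x) := by
  obtain ⟨G, hu, hs⟩ := hu
  refine ⟨fun x => -G x, hu.neg, fun g H hg => ?_⟩
  have hg' : IsTestFunction Ω A f g H := by
    refine ⟨hg.1, hg.2.1, ?_⟩
    have := hg.2.2.neg
    refine this.congr (Eventually.of_forall fun x => ?_)
    simp
  have := hs g H hg'
  simp only [map_neg, inner_neg_right, integral_neg, neg_mul]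
  linarith

lemma xNorm_neg (f : 𝔼 n → ℝ) : xNorm Ω A B w S (fun x => -f x) = xNorm Ω A B w S f := by
  simp [xNorm, integral_neg]

lemma IsAdmissible.neg {f : 𝔼 n → ℝ} (hf : IsAdmissible Ω A B w S f) :
    IsAdmissible Ω A B w S (fun x => -f x) := by
  refine ⟨fun v G hv => ?_, by rw [xNorm_neg]; exact hf.2⟩
  have := (hf.1 v G hv).neg
  refine this.congr (Eventually.of_forall fun x => ?_)
  simp

lemma exists_ae_le_of_eLpNorm_posPart_lt_top {X : Type*} [MeasurableSpace X] {μ : Measure X}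
    {u : X → ℝ} (hu : eLpNorm (fun y => max (u y) 0) ∞ μ < ∞) : ∃ K : ℝ, ∀ᵐ y ∂μ, u y ≤ K := by
  rw [eLpNorm_exponent_top] at hu
  refine ⟨(eLpNormEssSup (fun y => max (u y) 0) μ).toReal, ?_⟩
  filter_upwards [ae_le_eLpNormEssSup (f := fun y => max (u y) 0) (μ := μ)] with y hy
  rw [← ofReal_norm, ENNReal.ofReal_le_iff_le_toReal hu.ne,
    Real.norm_of_nonneg (le_max_right _ _)] at hy
  exact (le_max_left _ _).trans hy

lemma isLocallyBounded_of_forall_exists {u : 𝔼 n → ℝ}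
    (hu : ∀ x ∈ Ω, ∃ V, IsOpen V ∧ x ∈ V ∧ ∃ K : ℝ, ∀ᵐ y ∂volume.restrict V, ‖u y‖ ≤ K) :
    IsLocallyBounded Ω u := by
  intro S hS hSΩ
  have h1 : ∃ K : ℝ, ∀ᵐ y ∂volume.restrict S, ‖u y‖ ≤ K := by
    refine hS.induction_on (p := fun s => ∃ K : ℝ, ∀ᵐ y ∂volume.restrict s, ‖u y‖ ≤ K) ?_ ?_ ?_ ?_
    · exact ⟨0, by simp⟩
    · rintro s t hst ⟨K, hK⟩
      exact ⟨K, ae_mono (Measure.restrict_mono hst le_rfl) hK⟩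
    · rintro s t ⟨K, hK⟩ ⟨L, hL⟩
      refine ⟨max K L, ae_restrict_union_iff _ _ _ |>.2 ⟨?_, ?_⟩⟩
      · filter_upwards [hK] with y hy using hy.trans (le_max_left _ _)
      · filter_upwards [hL] with y hy using hy.trans (le_max_right _ _)
    · intro x hx
      obtain ⟨V, hV, hxV, hK⟩ := hu x (hSΩ hx)
      exact ⟨V, mem_nhdsWithin_of_mem_nhds (hV.mem_nhds hxV), hK⟩
  obtain ⟨K, hK⟩ := h1
  rw [eLpNorm_exponent_top]
  exact (eLpNormEssSup_le_of_ae_bound hK).trans_lt ENNReal.ofReal_lt_top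

end DegenerateDG


theorem theorem1 (k : ℕ) (hk : 1 ≤ k) (N : ℝ) (hN : 1 < N) (R cB CB CS Ccut : ℝ)
    (hR : 0 < R) (hcB : 0 < cB) (hCB : 0 < CB) (hCS : 0 < CS) (hCcut : 0 < Ccut) :
    ∃ C₁ C₂ : ℝ, 0 < C₁ ∧ 0 < C₂ ∧
      ∀ (n : ℕ) (Ω : Set (DegenerateDG.𝔼 n))
        (A B : DegenerateDG.𝔼 n → DegenerateDG.𝔼 n →L[ℝ] DegenerateDG.𝔼 n)
        (w : DegenerateDG.𝔼 n → ℝ) (d : DegenerateDG.𝔼 n → DegenerateDG.𝔼 n → ℝ)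
        (φ : ℝ → ℝ) (f : DegenerateDG.𝔼 n → ℝ) (𝓑 : Set (DegenerateDG.𝔼 n × ℝ)),
        DegenerateDG.DegenerateStructure Ω A B w cB CB →
        DegenerateDG.IsMetricOn Ω d →
        DegenerateDG.IsSuperradius R φ →
        -- `𝓑` is a family of metric balls of radius at most `R` and of finite `w`-measure
        (∀ x r, (x, r) ∈ 𝓑 → x ∈ Ω ∧ 0 < r ∧ r ≤ R ∧
          DegenerateDG.wMeasure Ω w (DegenerateDG.mball Ω d x r) < ∞) →
        (∀ x r, (x, r) ∈ 𝓑 →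
          DegenerateDG.OrliczSobolevOn Ω B w d (DegenerateDG.youngPhi k N) CS (φ r) x r) →
        (∀ x r, (x, r) ∈ 𝓑 → DegenerateDG.HasAdaptedCutoffs Ω B w d k N Ccut x r) →
        (∀ x r, (x, r) ∈ 𝓑 → DegenerateDG.IsAdmissible Ω A B w (DegenerateDG.mball Ω d x r) f) →
        (∀ u : DegenerateDG.𝔼 n → ℝ, DegenerateDG.IsWeakSubsolution Ω A f u →
          ∀ x r, (x, r) ∈ 𝓑 →
            eLpNorm (fun y => max (u y) 0) ∞ (volume.restrict (DegenerateDG.mball Ω d x (r / 2))) ≤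
              ENNReal.ofReal (DegenerateDG.innerConst k N C₁ C₂ φ r) *
                  ((DegenerateDG.wMeasure Ω w (DegenerateDG.mball Ω d x r))⁻¹ *
                    ∫⁻ y in DegenerateDG.mball Ω d x r, ENNReal.ofReal (max (u y) 0 ^ 2)
                      ∂DegenerateDG.wMeasure Ω w) ^ (1 / 2 : ℝ) +
                DegenerateDG.xNorm Ω A B w (DegenerateDG.mball Ω d x r) f) ∧
        ((∀ x ∈ Ω, ∀ ε : ℝ, 0 < ε → ∃ r, r < ε ∧ (x, r) ∈ 𝓑) →
          ∀ u : DegenerateDG.𝔼 n → ℝ, DegenerateDG.IsWeakSolution Ω A f u →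
            DegenerateDG.IsLocallyBounded Ω u) := by
  -- The constants are fixed from `iterationConst` before the dimension, the domain and the ball are
  -- introduced.
  have hD : 0 < DegenerateDG.iterationConst k N cB CB CS Ccut R := by
    have := DegenerateDG.energyConst_pos (k := k) (N := N) (R := R) hcB hCB hCcut
    unfold DegenerateDG.iterationConst
    positivity
  obtain ⟨C₁, C₂, hC₁, hC₂, hiter⟩ := DegenerateDG.exists_iteration_constants hk hN hD
  refine ⟨C₁, C₂, hC₁, hC₂, ?_⟩
  intro n Ω A B w d φ f 𝓑 h hd hφ h𝓑 hOS hcut hadm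
  have hbound : ∀ f' u : DegenerateDG.𝔼 n → ℝ,
      (∀ x r, (x, r) ∈ 𝓑 →
        DegenerateDG.IsAdmissible Ω A B w (DegenerateDG.mball Ω d x r) f') →
      DegenerateDG.IsWeakSubsolution Ω A f' u → ∀ x r, (x, r) ∈ 𝓑 → _ :=
    fun f' u hf' hu x r hxr =>
      have h1 := h𝓑 x r hxr
      hu.eLpNorm_le h hcB hCB hd h1.1 h1.2.1 h1.2.2.1 hk hN hCS hCcut hC₁
        (hφ.le r ⟨h1.2.1.le, h1.2.2.1⟩) hiter (hOS x r hxr) (hcut x r hxr) h1.2.2.2 (hf' x r hxr)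
  refine ⟨fun u hu => hbound f u hadm hu, fun hsmall u hu => ?_⟩
  have hupper : ∀ f' u : DegenerateDG.𝔼 n → ℝ,
      (∀ x r, (x, r) ∈ 𝓑 →
        DegenerateDG.IsAdmissible Ω A B w (DegenerateDG.mball Ω d x r) f') →
      DegenerateDG.IsWeakSubsolution Ω A f' u → ∀ x ∈ Ω, ∃ s, 0 < s ∧ ∃ K : ℝ,
        ∀ᵐ y ∂volume.restrict (DegenerateDG.mball Ω d x s), u y ≤ K := by
    intro f' u hf' hu x hx
    -- Any ball of the family at `x` provides a radius `s` with finite weighted integral of `u₊²`;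
    -- the estimate is then applied on a ball of the family of radius `t < s`.
    obtain ⟨r, -, hxr⟩ := hsmall x hx 1 one_pos
    have h1 := h𝓑 x r hxr
    obtain ⟨s, hs, hfin⟩ := hu.choose_spec.1.exists_lintegral_sq_lt_top h hcB hCB hd hx h1.2.1 hN
      (hOS x r hxr) (hcut x r hxr) h1.2.2.2
    obtain ⟨t, hts, hxt⟩ := hsmall x hx s hs
    have h2 := h𝓑 x t hxt
    refine ⟨t / 2, half_pos h2.2.1, DegenerateDG.exists_ae_le_of_eLpNorm_posPart_lt_top
      ((hbound f' u hf' hu x t hxt).trans_lt (ENNReal.add_lt_top.2 ⟨?_, (hf' x t hxt).2⟩))⟩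
    refine ENNReal.mul_lt_top ENNReal.ofReal_lt_top (ENNReal.rpow_lt_top_of_nonneg (by norm_num)
      (ENNReal.mul_ne_top (ENNReal.inv_ne_top.2
        (DegenerateDG.wMeasure_mball_ne_zero h hd hx h2.2.1)) ?_))
    exact ((lintegral_mono_set (DegenerateDG.mball_mono hts.le)).trans_lt hfin).ne
  refine DegenerateDG.isLocallyBounded_of_forall_exists fun x hx => ?_
  obtain ⟨s, hs, K, hK⟩ := hupper f u hadm hu.isWeakSubsolution x hx
  -- The lower bound comes from `-u`, a solution with right-hand side `-f`, which is admissible too.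
  obtain ⟨t, ht, L, hL⟩ := hupper (fun y => -f y) (fun y => -u y)
    (fun x r hxr => (hadm x r hxr).neg) hu.neg.isWeakSubsolution x hx
  refine ⟨DegenerateDG.mball Ω d x (min s t), hd.isOpen_ball x hx _, ⟨hx, ?_⟩, max K L, ?_⟩
  · rw [(hd.eq_zero_iff x hx x hx).2 rfl]
    exact lt_min hs ht
  · filter_upwards [ae_mono (Measure.restrict_mono
      (DegenerateDG.mball_mono (min_le_left s t)) le_rfl) hK,
      ae_mono (Measure.restrict_mono (DegenerateDG.mball_mono (min_le_right s t)) le_rfl) hL]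
      with y hy1 hy2
    rw [Real.norm_eq_abs, abs_le]
    exact ⟨by linarith [le_max_right K L], hy1.trans (le_max_left _ _)⟩
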